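/- **Theorem 1.2.** Let $q$ be a complex number with $0<|q|<1$, fix a fifth root $q^{1/5}$ of $q$, and put $q^{n/5}:=(q^{1/5})^n$. For each integer $n\ge 1$ let $$R(q^n):=\cfrac{q^{n/5}}{1+\cfrac{q^{n}}{1+\cfrac{q^{2n}}{1+\cfrac{q^{3n}}{1+\cdots}}}}$$ be the Rogers–Ramanujan continued fraction at $q^n$. These continued fractions converge, their values are nonzero, all denominators below are nonzero, and $$\frac{1}{R(q^{2})R(q^{3})}+R(q^{2})R(q^{3})= 1+\frac{R(q)}{R(q^{6})}+\frac{R(q^{6})}{R(q)},$$ $$R(q^{2})=\frac{R^2(q^{4})R(q^{8})-2R(q)R(q^{4})R(q^{16})+R(q^{4})R^2(q^{16})}{R^2(q)R(q^{4})R(q^{8})-2R(q)R(q^{4})R(q^{8})R(q^{16})+R^2(q)R^2(q^{16})},$$ $$R(q^6)= R(q)R^2(q^2)R(q^3)\cdot\frac{R(q)R(q^2)-R(q^3)+R^3(q)}{R^2(q)R(q^3)-R(q^2)R(q^3)+R^3(q)R(q^2)},$$ $$R(q^2)=\frac{R(q)R(q^3)}{R(q^6)}\cdot\frac{R(q) R^2(q^3)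 R(q^6)+2 R(q^6) R(q^{12})+ R(q) R(q^3) R^2(q^{12})}{R(q^3) R(q^6)+2 R(q) R^2(q^3) R(q^{12})+ R^2(q^{12})},$$ $$R(q^2)=\frac{1}{R(q)R(q^3)R(q^6)}\cdot\frac{2 R(q)R(q^3)R(q^6)R(q^{24})-R(q^4)R(q^6)R^2(q^{12})-R(q^4)R(q^{12})R^2(q^{24})}{R(q)R(q^3)R(q^6)R(q^{12})-2 R(q^4)R^2(q^{12})R(q^{24})+R(q)R(q^3)R^2(q^{24})}.$$ Here $R^k(x)$ means $(R(x))^k$. -/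

import Mathlib

open Filter Topology

/-- The Rogers–Ramanujan continued fraction
`q^{1/5} / (1 + q / (1 + q² / (1 + q³ / (1 + ⋯))))` as a formal continued fraction, where `t` is
the chosen value of `q^{1/5}`, so that `q = t ^ 5`. The integer part is `0`, all partial
denominators are `1`, and the partial numerators are `q^{1/5}, q, q², q³, …`. -/
noncomputable def rrContFract (t : ℂ) : GenContFract ℂ where
  h := 0
  s := Stream'.Seq.ofStream fun n => ⟨if n = 0 then t else (t ^ 5) ^ n, 1⟩

/-- The value `R(q)` of the Rogers–Ramanujan continued fraction at `q = t ^ 5`, with `q^{1/5} = t`: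
the limit of the convergents. With `q^{1/5} = t` fixed, `q^{n/5}` is `t ^ n`, and `R(q ^ n)` is
`rrR (t ^ n)`. -/
noncomputable def rrR (t : ℂ) : ℂ :=
  limUnder atTop (rrContFract t).convs

/-!
Write `q = t ^ 5` and `R_n = R(q ^ n)`. The convergents of the continued fraction satisfy the
recurrence `X (n + 2) = X (n + 1) + q ^ (n + 1) X n`, and the series `rrSum q k` of Rogers satisfy
the adjoint recurrence `rrSum_eq_add`. The pairing of the two is constant, so the convergents
converge, to `t * rrSum q 1 / rrSum q 0`. At `k = 0, 1` these series are theta series of nome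
`q ^ 5`, which do not vanish by the Jacobi triple product (`theta_eq_prod`); hence
`R(q) = t θ(q) / θ(q ^ 2)` and `R(q) ≠ 0`.

Splitting a product of two theta series by parity gives Weierstrass's three-term relation
(`theta_three_term`). Two instances of it yield the modular equation between `R_1` and `R_2`, and
four instances the one between `R_1` and `R_3` (`rrR_modular_two`, `rrR_modular_three`).

All identities of the theorem are algebraic consequences of these two equations and of analyticity.
Linear algebra over the monomials produces the relations in `R_1, R_2, R_4` and in
`R_1, R_2, R_3, R_6` which are needed, but only multiplied by a polynomial with non-zero constant
term. That factor cancels: `t ↦ R(t ^ 5)` is analytic on the disc and vanishes at the centre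
(`differentiableAt_rrR`, `rrR_zero`), and the analytic functions on the disc form a domain
(`eq_zero_of_mul_eq_zero_of_differentiableOn`). The relations which involve `R_12`, `R_8`, `R_16` or
`R_24` follow by elimination, with the help of
`(R_2 + R_1 ^ 2) (R_1 R_2 + R_4 ^ 2) = 2 R_1 R_4` (`add_sq_mul_add_sq`).

If a denominator vanished, elimination would force the parameter `k = R_m R_{2m} ^ 2`, for
`m = 1, 3` or `6`, to be a zero of `(1 - 4 k - k ^ 2) (1 + k - k ^ 2)`. Such a zero would persist
when `q` is replaced by `q ^ 2`, while the parameter tends to `0` under iteration, where the quartic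
has the value `1` (`rrParamQuartic_ne_zero`).
-/

/-! ### Infinite products -/

/-- The infinite `q`-Pochhammer symbol `(z; q)_∞ = ∏_{k ≥ 0} (1 - z q ^ k)`. -/
noncomputable def qPoch (q z : ℂ) : ℂ := ∏' k : ℕ, (1 - z * q ^ k)

lemma summable_mul_pow {q : ℂ} (hq : ‖q‖ < 1) (z : ℂ) : Summable fun k : ℕ => ‖-(z * q ^ k)‖ := by
  simp only [norm_neg, norm_mul, norm_pow]
  exact (summable_geometric_of_lt_one (norm_nonneg q) hq).mul_left _

lemma tendsto_qPoch {q : ℂ} (hq : ‖q‖ < 1) (z : ℂ) :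
    Tendsto (fun n : ℕ => ∏ k ∈ Finset.range n, (1 - z * q ^ k)) atTop (𝓝 (qPoch q z)) := by
  have h := (multipliable_one_add_of_summable (summable_mul_pow hq z)).tendsto_prod_tprod_nat
  simpa only [← sub_eq_add_neg, qPoch] using h

lemma qPoch_ne_zero {q z : ℂ} (hq : ‖q‖ < 1) (hz : ∀ k : ℕ, z * q ^ k ≠ 1) : qPoch q z ≠ 0 := by
  have h := tprod_one_add_ne_zero_of_summable (f := fun k : ℕ => -(z * q ^ k))
    (fun k hk => hz k (by linear_combination -hk)) (summable_mul_pow hq z)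
  simpa only [← sub_eq_add_neg, qPoch] using h

lemma qPoch_ne_zero_of_norm_lt {q z : ℂ} (hq : ‖q‖ < 1) (hz : ‖z‖ < 1) : qPoch q z ≠ 0 := by
  refine qPoch_ne_zero hq fun k hk => ?_
  have h1 : ‖z * q ^ k‖ < 1 := by
    rw [norm_mul, norm_pow]
    calc ‖z‖ * ‖q‖ ^ k ≤ ‖z‖ * 1 := by gcongr; exact pow_le_one₀ (norm_nonneg q) hq.le
      _ < 1 := by simpa using hz
  rw [hk] at h1
  simp at h1

lemma qPoch_eq_mul {q : ℂ} (hq : ‖q‖ < 1) (z : ℂ) : qPoch q z = (1 - z) * qPoch q (z * q) := by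
  have h1 := (tendsto_qPoch hq z).comp (tendsto_add_atTop_nat 1)
  have h2 := (tendsto_qPoch hq (z * q)).const_mul (1 - z)
  refine tendsto_nhds_unique h1 (h2.congr fun n => ?_)
  simp only [Function.comp, Finset.prod_range_succ', pow_zero, mul_one]
  rw [mul_comm]
  congr 1
  exact Finset.prod_congr rfl fun k _ => by ring

/-- Splitting the factors of `(z; q)_∞` according to the residue of the index modulo `N`. -/
lemma qPoch_eq_prod {q : ℂ} (hq : ‖q‖ < 1) (z : ℂ) {N : ℕ} (hN : 0 < N) :
    qPoch q z = ∏ i ∈ Finset.range N, qPoch (q ^ N) (z * q ^ i) := by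
  have hqN : ‖q ^ N‖ < 1 := by
    rw [norm_pow]; exact pow_lt_one₀ (norm_nonneg q) hq hN.ne'
  have h1 : Tendsto (fun n : ℕ => N * n) atTop atTop :=
    tendsto_atTop_mono (fun n => Nat.le_mul_of_pos_left n hN) tendsto_id
  have h2 := tendsto_finsetProd (Finset.range N) fun i _ => tendsto_qPoch hqN (z * q ^ i)
  refine tendsto_nhds_unique ((tendsto_qPoch hq z).comp h1) (h2.congr fun n => ?_)
  simp only [Function.comp]
  induction n with
  | zero => simp
  | succ n ih =>
    rw [Nat.mul_succ, Finset.prod_range_add, ← ih, ← Finset.prod_mul_distrib]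
    refine Finset.prod_congr rfl fun i _ => ?_
    rw [Finset.prod_range_succ]
    ring

/-- The finite `q`-Pochhammer symbol `(q; q)_m` has a bounded inverse. -/
lemma exists_norm_inv_qFactorial_le {q : ℂ} (hq : ‖q‖ < 1) :
    ∃ C : ℝ, ∀ m : ℕ, ‖(∏ k ∈ Finset.range m, (1 - q * q ^ k))⁻¹‖ ≤ C := by
  have h := ((tendsto_qPoch hq q).inv₀ (qPoch_ne_zero_of_norm_lt hq hq)).norm
  obtain ⟨C, hC⟩ := h.bddAbove_range
  exact ⟨C, fun m => hC ⟨m, rfl⟩⟩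

lemma one_sub_mul_pow_ne_zero {q : ℂ} (hq : ‖q‖ < 1) (k : ℕ) : 1 - q * q ^ k ≠ 0 := by
  intro h
  have h1 : ‖q ^ (k + 1)‖ < 1 := by
    rw [norm_pow]; exact pow_lt_one₀ (norm_nonneg q) hq k.succ_ne_zero
  rw [show q ^ (k + 1) = 1 by linear_combination -h] at h1
  simp at h1

/-! ### The theta series -/

/-- The general term `(-1) ^ n q ^ (n (n - 1) / 2) z ^ n` of the theta series. -/
noncomputable def thetaTerm (q z : ℂ) (n : ℤ) : ℂ := q ^ (n * (n - 1) / 2) * (-z) ^ n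

/-- The theta function `∑_{n ∈ ℤ} (-1) ^ n q ^ (n (n - 1) / 2) z ^ n`. -/
noncomputable def theta (q z : ℂ) : ℂ := ∑' n : ℤ, thetaTerm q z n

lemma int_triangle_add (a b : ℤ) :
    (a + b) * (a + b - 1) / 2 = a * (a - 1) / 2 + b * (b - 1) / 2 + a * b := by
  obtain ⟨c, hc⟩ := Int.even_mul_pred_self a
  obtain ⟨d, hd⟩ := Int.even_mul_pred_self b
  have h : (a + b) * (a + b - 1) = (c + d + a * b) * 2 := by linear_combination hc + hd
  rw [h, hc, hd, Int.mul_ediv_cancel _ two_ne_zero]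
  omega

lemma thetaTerm_add {q z : ℂ} (hq : q ≠ 0) (hz : z ≠ 0) (a b : ℤ) :
    thetaTerm q z (a + b) = thetaTerm q z a * thetaTerm q (z * q ^ a) b := by
  simp only [thetaTerm]
  rw [int_triangle_add, zpow_add₀ hq, zpow_add₀ hq, zpow_add₀ (neg_ne_zero.2 hz), ← neg_mul,
    mul_zpow, ← zpow_mul]
  ring

@[simp] lemma thetaTerm_zero (q z : ℂ) : thetaTerm q z 0 = 1 := by simp [thetaTerm]

@[simp] lemma thetaTerm_one (q z : ℂ) : thetaTerm q z 1 = -z := by simp [thetaTerm]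

lemma thetaTerm_ne_zero {q z : ℂ} (hq : q ≠ 0) (hz : z ≠ 0) (n : ℤ) : thetaTerm q z n ≠ 0 :=
  mul_ne_zero (zpow_ne_zero _ hq) (zpow_ne_zero _ (neg_ne_zero.2 hz))

lemma thetaTerm_succ {q z : ℂ} (hq : q ≠ 0) (hz : z ≠ 0) (n : ℤ) :
    thetaTerm q z (n + 1) = -(z * q ^ n) * thetaTerm q z n := by
  rw [thetaTerm_add hq hz, thetaTerm_one]
  ring

lemma thetaTerm_neg {q z : ℂ} (hq : q ≠ 0) (n : ℤ) :
    thetaTerm q z (-n) = thetaTerm q (q / z) n := by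
  obtain ⟨c, hc⟩ := Int.even_mul_pred_self n
  simp only [thetaTerm]
  have h1 : -n * (-n - 1) / 2 = c + n := by
    rw [show -n * (-n - 1) = (c + n) * 2 by linear_combination hc,
      Int.mul_ediv_cancel _ two_ne_zero]
  have h2 : n * (n - 1) / 2 = c := by rw [hc]; omega
  rw [h1, h2, zpow_add₀ hq, zpow_neg, ← inv_zpow, show -(q / z) = q * (-z)⁻¹ by
    rw [inv_neg]; ring, mul_zpow]
  ring

lemma summable_thetaTerm_nat {q z : ℂ} (hq0 : q ≠ 0) (hq : ‖q‖ < 1) (hz : z ≠ 0) :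
    Summable fun n : ℕ => ‖thetaTerm q z n‖ := by
  refine summable_of_ratio_test_tendsto_lt_one (l := 0) zero_lt_one
    (Eventually.of_forall fun n => norm_ne_zero_iff.2 (thetaTerm_ne_zero hq0 hz n)) ?_
  have h1 : Tendsto (fun n : ℕ => ‖z‖ * ‖q‖ ^ n) atTop (𝓝 0) := by
    simpa using (tendsto_pow_atTop_nhds_zero_of_lt_one (norm_nonneg q) hq).const_mul ‖z‖
  refine h1.congr fun n => ?_
  push_cast
  rw [norm_norm, norm_norm, thetaTerm_succ hq0 hz, norm_mul,
    mul_div_cancel_right₀ _ (norm_ne_zero_iff.2 (thetaTerm_ne_zero hq0 hz n))]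
  simp

lemma summable_norm_thetaTerm {q z : ℂ} (hq0 : q ≠ 0) (hq : ‖q‖ < 1) (hz : z ≠ 0) :
    Summable fun n : ℤ => ‖thetaTerm q z n‖ := by
  refine Summable.of_nat_of_neg (summable_thetaTerm_nat hq0 hq hz) ?_
  simp only [thetaTerm_neg hq0]
  exact summable_thetaTerm_nat hq0 hq (div_ne_zero hq0 hz)

lemma theta_div {q z : ℂ} (hq : q ≠ 0) : theta q (q / z) = theta q z := by
  simp only [theta, ← thetaTerm_neg hq]
  exact (Equiv.neg ℤ).tsum_eq (thetaTerm q z)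

/-! ### The Jacobi triple product -/

/-- Euler's expansion `(z; q)_∞ = ∑_m (-1) ^ m q ^ (m (m - 1) / 2) z ^ m / (q; q)_m`. -/
lemma tsum_euler {q z : ℂ} (hq0 : q ≠ 0) (hq : ‖q‖ < 1) (hz : z ≠ 0) :
    ∑' m : ℕ, thetaTerm q z m * (∏ k ∈ Finset.range m, (1 - q * q ^ k))⁻¹ = qPoch q z := by
  obtain ⟨C, hC⟩ := exists_norm_inv_qFactorial_le hq
  set c : ℕ → ℂ := fun m => (∏ k ∈ Finset.range m, (1 - q * q ^ k))⁻¹ with hc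
  have hsum : ∀ w : ℂ, w ≠ 0 → Summable fun m : ℕ => thetaTerm q w m * c m := fun w hw =>
    Summable.of_norm_bounded ((summable_thetaTerm_nat hq0 hq hw).mul_right C) fun m => by
      rw [norm_mul]; gcongr; exact hC m
  have hcs : ∀ m, c (m + 1) * (1 - q * q ^ m) = c m := fun m => by
    simp only [hc, Finset.prod_range_succ, mul_inv]
    rw [inv_mul_cancel_right₀ (one_sub_mul_pow_ne_zero hq m)]
  have hmul : ∀ w (m : ℕ), thetaTerm q (w * q) m = q ^ m * thetaTerm q w m := fun w m => by
    simp only [thetaTerm, zpow_natCast]; ring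
  -- the functional equation `f(w) = (1 - w) f(w q)`
  have hfe : ∀ w : ℂ, w ≠ 0 → ∑' m : ℕ, thetaTerm q w m * c m =
      (1 - w) * ∑' m : ℕ, thetaTerm q (w * q) m * c m := fun w hw => by
    have hs := hsum w hw
    have hsq := hsum (w * q) (mul_ne_zero hw hq0)
    have h1 : ∑' m : ℕ, (thetaTerm q w m * c m - thetaTerm q (w * q) m * c m) =
        ∑' m : ℕ, -w * (thetaTerm q (w * q) m * c m) := by
      rw [(hs.sub hsq).tsum_eq_zero_add]
      simp only [Nat.cast_zero, thetaTerm_zero, sub_self, zero_add]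
      refine tsum_congr fun m => ?_
      rw [hmul, hmul, ← hcs m]
      push_cast
      rw [thetaTerm_succ hq0 hw, zpow_natCast]
      ring
    rw [hs.tsum_sub hsq, tsum_mul_left] at h1
    linear_combination h1
  have hmuln : ∀ n m : ℕ, thetaTerm q (z * q ^ n) m = (q ^ m) ^ n * thetaTerm q z m :=
    fun n m => by simp only [thetaTerm, zpow_natCast]; ring
  have hiter : ∀ n : ℕ, ∑' m : ℕ, thetaTerm q z m * c m =
      (∏ k ∈ Finset.range n, (1 - z * q ^ k)) * ∑' m : ℕ, thetaTerm q (z * q ^ n) m * c m := by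
    intro n
    induction n with
    | zero => simp
    | succ n ih =>
      rw [ih, hfe _ (mul_ne_zero hz (pow_ne_zero n hq0)), Finset.prod_range_succ, pow_succ,
        mul_assoc z]
      ring
  have hlim : Tendsto (fun n : ℕ => ∑' m : ℕ, thetaTerm q (z * q ^ n) m * c m) atTop
      (𝓝 (∑' m : ℕ, if m = 0 then 1 else 0)) := by
    refine tendsto_tsum_of_dominated_convergence
      ((summable_thetaTerm_nat hq0 hq hz).mul_right C) (fun m => ?_)
      (Eventually.of_forall fun n m => ?_)
    · rcases Nat.eq_zero_or_pos m with rfl | hm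
      · simp [hc]
      · rw [if_neg hm.ne']
        have h1 : Tendsto (fun n : ℕ => thetaTerm q z m * c m * (q ^ m) ^ n) atTop
            (𝓝 (thetaTerm q z m * c m * 0)) :=
          (tendsto_pow_atTop_nhds_zero_of_norm_lt_one
            (by rw [norm_pow]; exact pow_lt_one₀ (norm_nonneg q) hq hm.ne')).const_mul _
        rw [mul_zero] at h1
        refine h1.congr fun n => ?_
        rw [hmuln]
        ring
    · have h1 : ‖thetaTerm q (z * q ^ n) m‖ ≤ ‖thetaTerm q z m‖ := by
        rw [hmuln, norm_mul, norm_pow, norm_pow]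
        exact mul_le_of_le_one_left (norm_nonneg _)
          (pow_le_one₀ (by positivity) (pow_le_one₀ (norm_nonneg q) hq.le))
      rw [norm_mul]
      gcongr
      exact hC m
  have h := (tendsto_qPoch hq z).mul hlim
  rw [tsum_ite_eq, mul_one] at h
  exact tendsto_nhds_unique (tendsto_const_nhds.congr hiter) h

/-- The Jacobi triple product `θ(z) = (q; q)_∞ (z; q)_∞ (q / z; q)_∞`. It is the limit, as
`k → ∞`, of Euler's expansion at `z q ^ (-k)` with the summation index shifted by `k`. -/
theorem theta_eq_prod {q z : ℂ} (hq0 : q ≠ 0) (hq : ‖q‖ < 1) (hz : z ≠ 0) :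
    theta q z = qPoch q q * qPoch q z * qPoch q (q / z) := by
  obtain ⟨C, hC⟩ := exists_norm_inv_qFactorial_le hq
  set c : ℕ → ℂ := fun m => (∏ k ∈ Finset.range m, (1 - q * q ^ k))⁻¹ with hc
  have hshift : ∀ k : ℕ, thetaTerm q z (-k) * qPoch q (z * q ^ (-k : ℤ)) =
      (∏ i ∈ Finset.range k, (1 - q / z * q ^ i)) * qPoch q z := by
    intro k
    induction k with
    | zero => simp
    | succ k ih =>
      rw [qPoch_eq_mul hq, Finset.prod_range_succ, mul_right_comm _ _ (qPoch q z), ← ih]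
      have e1 : z * q ^ (-((k + 1 : ℕ) : ℤ)) * q = z * q ^ (-k : ℤ) := by
        rw [mul_assoc, ← zpow_add_one₀ hq0]; congr 2; push_cast; ring
      have e2 : thetaTerm q z (-k) = -(z * q ^ (-((k + 1 : ℕ) : ℤ))) *
          thetaTerm q z (-((k + 1 : ℕ) : ℤ)) := by
        rw [← thetaTerm_succ hq0 hz]; congr 1; push_cast; ring
      have e3 : z * q ^ (-((k + 1 : ℕ) : ℤ)) * (q / z * q ^ k) = 1 := by
        rw [zpow_neg, zpow_natCast]; field_simp; ring
      rw [e1, e2]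
      linear_combination (-(thetaTerm q z (-((k + 1 : ℕ) : ℤ)) * qPoch q (z * q ^ (-k : ℤ)))) * e3
  set F : ℕ → ℤ → ℂ := fun k n => if 0 ≤ n + k then thetaTerm q z n * c (n + k).toNat else 0
    with hF
  have hsumF : ∀ k : ℕ, ∑' n : ℤ, F k n =
      (∏ i ∈ Finset.range k, (1 - q / z * q ^ i)) * qPoch q z := by
    intro k
    have hinj : Function.Injective fun m : ℕ => (m : ℤ) - k := fun a b hab => by
      simp only at hab; omega
    rw [← hinj.tsum_eq]
    · rw [← hshift, ← tsum_euler hq0 hq (mul_ne_zero hz (zpow_ne_zero _ hq0)), ← tsum_mul_left]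
      refine tsum_congr fun m => ?_
      simp only [hF, sub_add_cancel, Nat.cast_nonneg, if_true, Int.toNat_natCast, ← mul_assoc, hc]
      rw [← thetaTerm_add hq0 hz, neg_add_eq_sub]
    · intro n hn
      have h0 : 0 ≤ n + k := by
        by_contra h
        exact hn (by simp [hF, h])
      exact ⟨(n + k).toNat, by simp only [Int.toNat_of_nonneg h0]; ring⟩
  have hlim : Tendsto (fun k : ℕ => ∑' n : ℤ, F k n) atTop
      (𝓝 (∑' n : ℤ, thetaTerm q z n * (qPoch q q)⁻¹)) := by
    refine tendsto_tsum_of_dominated_convergence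
      ((summable_norm_thetaTerm hq0 hq hz).mul_right C) (fun n => ?_)
      (Eventually.of_forall fun k n => ?_)
    · have h1 : Tendsto (fun k : ℕ => (n + k).toNat) atTop atTop :=
        tendsto_atTop.2 fun b => by
          filter_upwards [eventually_ge_atTop (b + n.natAbs)] with k hk
          omega
      have h2 := (((tendsto_qPoch hq q).inv₀ (qPoch_ne_zero_of_norm_lt hq hq)).comp h1).const_mul
        (thetaTerm q z n)
      refine h2.congr' ?_
      filter_upwards [eventually_ge_atTop n.natAbs] with k hk
      have : 0 ≤ n + k := by omega
      simp [hF, this, hc]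
    · simp only [hF]
      split_ifs
      · rw [norm_mul]; gcongr; exact hC _
      · rw [norm_zero]
        exact mul_nonneg (norm_nonneg _) ((norm_nonneg _).trans (hC 0))
  have h := (tendsto_qPoch hq (q / z)).mul_const (qPoch q z)
  rw [tsum_mul_right] at hlim
  have h3 := tendsto_nhds_unique hlim (h.congr fun k => (hsumF k).symm)
  have h4 : qPoch q q ≠ 0 := qPoch_ne_zero_of_norm_lt hq hq
  rw [theta, mul_assoc, mul_comm (qPoch q z), ← h3, mul_comm (∑' _, _), mul_inv_cancel_left₀ h4]

lemma theta_ne_zero {q z : ℂ} (hq0 : q ≠ 0) (hq : ‖q‖ < 1) (hz : ‖z‖ < 1) (hqz : ‖q‖ < ‖z‖) :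
    theta q z ≠ 0 := by
  have hz0 : z ≠ 0 := norm_pos_iff.1 ((norm_nonneg q).trans_lt hqz)
  rw [theta_eq_prod hq0 hq hz0]
  refine mul_ne_zero (mul_ne_zero (qPoch_ne_zero_of_norm_lt hq hq)
    (qPoch_ne_zero_of_norm_lt hq hz)) (qPoch_ne_zero_of_norm_lt hq ?_)
  rwa [norm_div, div_lt_one (norm_pos_iff.2 hz0)]

lemma theta_pow_ne_zero {q : ℂ} (hq0 : q ≠ 0) (hq : ‖q‖ < 1) {k N : ℕ} (hk : 0 < k)
    (hkN : k < N) : theta (q ^ N) (q ^ k) ≠ 0 := by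
  refine theta_ne_zero (pow_ne_zero _ hq0) ?_ ?_ ?_ <;> simp only [norm_pow]
  · exact pow_lt_one₀ (norm_nonneg q) hq (by omega)
  · exact pow_lt_one₀ (norm_nonneg q) hq hk.ne'
  · exact pow_lt_pow_right_of_lt_one₀ (norm_pos_iff.2 hq0) hq hkN

lemma theta_pow_reflect {q : ℂ} (hq0 : q ≠ 0) {k N : ℕ} (hkN : k ≤ N) :
    theta (q ^ N) (q ^ (N - k)) = theta (q ^ N) (q ^ k) := by
  rw [← theta_div (pow_ne_zero N hq0) (z := q ^ k)]
  congr 1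
  rw [eq_div_iff (pow_ne_zero k hq0), ← pow_add, Nat.sub_add_cancel hkN]

/-- Passing from the nome `q` to the nome `q ^ N`, up to a factor independent of `z`. -/
lemma theta_eq_mul_prod {q : ℂ} (hq0 : q ≠ 0) (hq : ‖q‖ < 1) {N : ℕ} (hN : 0 < N) :
    ∃ K : ℂ, K ≠ 0 ∧ ∀ z : ℂ, z ≠ 0 →
      theta q z = K * ∏ i ∈ Finset.range N, theta (q ^ N) (z * q ^ i) := by
  have hqN0 : q ^ N ≠ 0 := pow_ne_zero N hq0
  have hqN : ‖q ^ N‖ < 1 := by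
    rw [norm_pow]; exact pow_lt_one₀ (norm_nonneg q) hq hN.ne'
  have h0 : qPoch q q ≠ 0 := qPoch_ne_zero_of_norm_lt hq hq
  have h1 : qPoch (q ^ N) (q ^ N) ≠ 0 := qPoch_ne_zero_of_norm_lt hqN hqN
  refine ⟨qPoch q q / qPoch (q ^ N) (q ^ N) ^ N, div_ne_zero h0 (pow_ne_zero N h1),
    fun z hz => ?_⟩
  rw [theta_eq_prod hq0 hq hz, qPoch_eq_prod hq z hN, qPoch_eq_prod hq (q / z) hN,
    ← Finset.prod_range_reflect (fun i => qPoch (q ^ N) (q / z * q ^ i))]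
  rw [Finset.prod_congr rfl fun i _ => theta_eq_prod hqN0 hqN (mul_ne_zero hz (pow_ne_zero i hq0)),
    Finset.prod_mul_distrib, Finset.prod_mul_distrib, Finset.prod_const, Finset.card_range]
  have h2 : ∀ i ∈ Finset.range N, q / z * q ^ (N - 1 - i) = q ^ N / (z * q ^ i) := by
    intro i hi
    have hi' : N = 1 + (N - 1 - i) + i := by have := Finset.mem_range.1 hi; omega
    rw [div_mul_eq_mul_div, div_eq_div_iff hz (mul_ne_zero hz (pow_ne_zero i hq0))]
    conv_rhs => rw [hi']
    ring
  have h3 : ∏ i ∈ Finset.range N, qPoch (q ^ N) (q / z * q ^ (N - 1 - i)) =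
      ∏ i ∈ Finset.range N, qPoch (q ^ N) (q ^ N / (z * q ^ i)) :=
    Finset.prod_congr rfl fun i hi => by rw [h2 i hi]
  rw [h3]
  field_simp

/-! ### The three-term relation -/

/-- A product of two theta values separates into two products of functions of `x` and of `y`:
split the double series according to the parity of the sum of its two indices. -/
lemma theta_mul_theta {q x y : ℂ} (hq0 : q ≠ 0) (hq : ‖q‖ < 1) (hx : x ≠ 0) (hy : y ≠ 0) :
    theta q (x * y) * theta q (x / y) =
      theta (q ^ 2) (-x ^ 2) * theta (q ^ 2) (-(q * y ^ 2)) -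
        x / y * (theta (q ^ 2) (-(q * x ^ 2)) * theta (q ^ 2) (-y ^ 2)) := by
  have hq2 : q ^ 2 ≠ 0 := pow_ne_zero 2 hq0
  have hq2' : ‖q ^ 2‖ < 1 := by
    rw [norm_pow]; exact pow_lt_one₀ (norm_nonneg q) hq two_ne_zero
  have hx2 : -x ^ 2 ≠ 0 := neg_ne_zero.2 (pow_ne_zero 2 hx)
  have hy2 : -y ^ 2 ≠ 0 := neg_ne_zero.2 (pow_ne_zero 2 hy)
  have hqx : -(q * x ^ 2) ≠ 0 := neg_ne_zero.2 (mul_ne_zero hq0 (pow_ne_zero 2 hx))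
  have hqy : -(q * y ^ 2) ≠ 0 := neg_ne_zero.2 (mul_ne_zero hq0 (pow_ne_zero 2 hy))
  have sxy := summable_norm_thetaTerm hq0 hq (mul_ne_zero hx hy)
  have sxd := summable_norm_thetaTerm hq0 hq (div_ne_zero hx hy)
  have s1 := summable_norm_thetaTerm hq2 hq2' hx2
  have s2 := summable_norm_thetaTerm hq2 hq2' hqy
  have s3 := summable_norm_thetaTerm hq2 hq2' hqx
  have s4 := summable_norm_thetaTerm hq2 hq2' hy2
  have hbij : Function.Bijective (Sum.elim (fun p : ℤ × ℤ => (p.1 + p.2, p.1 - p.2))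
      (fun p : ℤ × ℤ => (p.1 + p.2, p.1 - p.2 + 1))) := by
    constructor
    · rintro (⟨a, b⟩ | ⟨a, b⟩) (⟨c, d⟩ | ⟨c, d⟩) h <;>
        simp only [Sum.elim_inl, Sum.elim_inr, Prod.mk.injEq, Sum.inl.injEq, Sum.inr.injEq,
          reduceCtorEq] at h ⊢ <;> omega
    · rintro ⟨m, n⟩
      rcases Int.even_or_odd' (m + n) with ⟨k, hk | hk⟩
      · exact ⟨Sum.inl (k, m - k), by
          simp only [Sum.elim_inl, Prod.mk.injEq]; omega⟩
      · exact ⟨Sum.inr (k, m - k), by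
          simp only [Sum.elim_inr, Prod.mk.injEq]; omega⟩
  have hterm0 : ∀ p : ℤ × ℤ, thetaTerm q (x * y) (p.1 + p.2) * thetaTerm q (x / y) (p.1 - p.2) =
      thetaTerm (q ^ 2) (-x ^ 2) p.1 * thetaTerm (q ^ 2) (-(q * y ^ 2)) p.2 := by
    rintro ⟨i, j⟩
    obtain ⟨c, hc⟩ := Int.even_mul_pred_self i
    obtain ⟨d, hd⟩ := Int.even_mul_pred_self j
    have e1 : (i + j) * (i + j - 1) / 2 = c + d + i * j := by
      rw [int_triangle_add, hc, hd]; omega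
    have e2 : (i - j) * (i - j - 1) / 2 = c + d + j - i * j := by
      rw [show (i - j) * (i - j - 1) = (c + d + j - i * j) * 2 by linear_combination hc + hd,
        Int.mul_ediv_cancel _ two_ne_zero]
    have e3 : i * (i - 1) / 2 = c := by omega
    have e4 : j * (j - 1) / 2 = d := by omega
    simp only [thetaTerm, e1, e2, e3, e4, neg_neg]
    have f1 : (-(x * y)) ^ (i + j) * (-(x / y)) ^ (i - j) = (x ^ 2) ^ i * (y ^ 2) ^ j := by
      rw [show -(x / y) = -(x * y) * (y ^ 2)⁻¹ by field_simp, mul_zpow, ← mul_assoc,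
        ← zpow_add₀ (neg_ne_zero.2 (mul_ne_zero hx hy)), inv_zpow', neg_sub, zpow_sub₀
        (pow_ne_zero 2 hy), show i + j + (i - j) = 2 * i by ring, zpow_mul,
        show (-(x * y)) ^ (2 : ℤ) = x ^ 2 * y ^ 2 by norm_cast; ring, mul_zpow]
      field_simp
    have f2 : q ^ (c + d + i * j) * q ^ (c + d + j - i * j) = (q ^ 2) ^ c * ((q ^ 2) ^ d * q ^ j)
        := by
      rw [← zpow_add₀ hq0, show c + d + i * j + (c + d + j - i * j) = 2 * c + (2 * d + j) by ring,
        zpow_add₀ hq0, zpow_add₀ hq0, zpow_mul, zpow_mul]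
      norm_cast
    rw [mul_zpow]
    linear_combination (q ^ (c + d + i * j) * q ^ (c + d + j - i * j)) * f1 +
      ((x ^ 2) ^ i * (y ^ 2) ^ j) * f2
  have hterm1 : ∀ p : ℤ × ℤ,
      thetaTerm q (x * y) (p.1 + p.2) * thetaTerm q (x / y) (p.1 - p.2 + 1) =
      -(x / y) * (thetaTerm (q ^ 2) (-(q * x ^ 2)) p.1 * thetaTerm (q ^ 2) (-y ^ 2) p.2) := by
    rintro ⟨i, j⟩
    have h := hterm0 (i, j)
    simp only at h ⊢
    have g1 : thetaTerm (q ^ 2) (-(q * x ^ 2)) i = q ^ i * thetaTerm (q ^ 2) (-x ^ 2) i := by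
      simp only [thetaTerm, neg_neg, mul_zpow]; ring
    have g2 : thetaTerm (q ^ 2) (-(q * y ^ 2)) j = q ^ j * thetaTerm (q ^ 2) (-y ^ 2) j := by
      simp only [thetaTerm, neg_neg, mul_zpow]; ring
    have hqj : q ^ j ≠ 0 := zpow_ne_zero j hq0
    rw [thetaTerm_succ hq0 (div_ne_zero hx hy), g1, zpow_sub₀ hq0]
    rw [g2] at h
    field_simp
    linear_combination -h
  have H : HasSum (fun p : ℤ × ℤ => thetaTerm q (x * y) p.1 * thetaTerm q (x / y) p.2)
      (theta q (x * y) * theta q (x / y)) := by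
    have := (summable_mul_of_summable_norm sxy sxd).hasSum
    rwa [← tsum_mul_tsum_of_summable_norm sxy sxd] at this
  have H0 := (summable_mul_of_summable_norm s1 s2).hasSum
  have H1 := (summable_mul_of_summable_norm s3 s4).hasSum.mul_left (-(x / y))
  rw [← tsum_mul_tsum_of_summable_norm s1 s2] at H0
  rw [← tsum_mul_tsum_of_summable_norm s3 s4] at H1
  have H2 : HasSum ((fun p : ℤ × ℤ => thetaTerm q (x * y) p.1 * thetaTerm q (x / y) p.2) ∘
      Equiv.ofBijective _ hbij) _ :=
    HasSum.sum (H0.congr_fun fun p => hterm0 p) (H1.congr_fun fun p => hterm1 p)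
  have H3 := ((Equiv.ofBijective _ hbij).hasSum_iff.1 H2).unique H
  simp only [theta] at H3 ⊢
  linear_combination -H3

/-- The three-term relation of Weierstrass, as a Plücker relation: up to the factor `x`, the product
`θ(x y) θ(x / y)` is a two-by-two determinant in `x` and `y`. -/
theorem theta_three_term {q x y z w : ℂ} (hq0 : q ≠ 0) (hq : ‖q‖ < 1) (hx : x ≠ 0) (hy : y ≠ 0)
    (hz : z ≠ 0) (hw : w ≠ 0) :
    y * (theta q (x * y) * theta q (x / y) * (theta q (z * w) * theta q (z / w))) -
      z * (theta q (x * z) * theta q (x / z) * (theta q (y * w) * theta q (y / w))) +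
      z * (theta q (x * w) * theta q (x / w) * (theta q (y * z) * theta q (y / z))) = 0 := by
  rw [theta_mul_theta hq0 hq hx hy, theta_mul_theta hq0 hq hz hw, theta_mul_theta hq0 hq hx hz,
    theta_mul_theta hq0 hq hy hw, theta_mul_theta hq0 hq hx hw, theta_mul_theta hq0 hq hy hz]
  field_simp
  ring

/-- The three-term relation at four powers of `p`, with nome `p ^ N`. With `p ^ 2 = q` it covers
half-integral exponents of `q`. -/
lemma theta_three_term_pow {p : ℂ} (hp0 : p ≠ 0) (hp : ‖p‖ < 1) {N : ℕ} (hN : 0 < N)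
    {a b c d : ℕ} (hab : b ≤ a) (hbc : c ≤ b) (hcd : d ≤ c) :
    p ^ b * (theta (p ^ N) (p ^ (a + b)) * theta (p ^ N) (p ^ (a - b)) *
        (theta (p ^ N) (p ^ (c + d)) * theta (p ^ N) (p ^ (c - d)))) -
      p ^ c * (theta (p ^ N) (p ^ (a + c)) * theta (p ^ N) (p ^ (a - c)) *
        (theta (p ^ N) (p ^ (b + d)) * theta (p ^ N) (p ^ (b - d)))) +
      p ^ c * (theta (p ^ N) (p ^ (a + d)) * theta (p ^ N) (p ^ (a - d)) *
        (theta (p ^ N) (p ^ (b + c)) * theta (p ^ N) (p ^ (b - c)))) = 0 := by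
  have hpN : ‖p ^ N‖ < 1 := by
    rw [norm_pow]; exact pow_lt_one₀ (norm_nonneg p) hp hN.ne'
  have h : ∀ k : ℕ, p ^ k ≠ 0 := fun k => pow_ne_zero k hp0
  have hdiv : ∀ m n : ℕ, n ≤ m → p ^ (m - n) = p ^ m / p ^ n := fun m n hmn =>
    pow_sub₀ p hp0 hmn |>.trans (div_eq_mul_inv _ _).symm
  have := theta_three_term (h N) hpN (h a) (h b) (h c) (h d)
  rw [hdiv a b hab, hdiv c d hcd, hdiv a c (hbc.trans hab), hdiv b d (hcd.trans hbc),
    hdiv a d ((hcd.trans hbc).trans hab), hdiv b c hbc]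
  simpa only [pow_add] using this

/-! ### The Rogers–Ramanujan recurrence -/

lemma norm_one_sub_pow_le_two {q : ℂ} (hq : ‖q‖ ≤ 1) (j : ℕ) : ‖1 - q ^ j‖ ≤ 2 := by
  calc ‖1 - q ^ j‖ ≤ ‖(1 : ℂ)‖ + ‖q ^ j‖ := norm_sub_le _ _
    _ ≤ 1 + 1 := by
      rw [norm_one, norm_pow]
      gcongr
      exact pow_le_one₀ (norm_nonneg q) hq
    _ = 2 := by norm_num

lemma prod_one_add_pow_le {r : ℝ} (hr0 : 0 ≤ r) (hr : r < 1) (k : ℕ) :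
    ∏ i ∈ Finset.range k, (1 + r ^ i) ≤ Real.exp (1 - r)⁻¹ := by
  calc ∏ i ∈ Finset.range k, (1 + r ^ i)
      ≤ ∏ i ∈ Finset.range k, Real.exp (r ^ i) := by
        refine Finset.prod_le_prod (fun i _ => by positivity) fun i _ => ?_
        rw [add_comm]
        exact Real.add_one_le_exp _
    _ = Real.exp (∑ i ∈ Finset.range k, r ^ i) := (Real.exp_sum _ _).symm
    _ ≤ Real.exp (1 - r)⁻¹ := by
        refine Real.exp_le_exp.2 ?_
        rw [← tsum_geometric_of_lt_one hr0 hr]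
        exact (summable_geometric_of_lt_one hr0 hr).sum_le_tsum _ fun i _ => by positivity

/-- The product `(1 - q ^ (r + 1)) ⋯ (1 - q ^ (r + k))`. -/
noncomputable def shiftedProd (q : ℂ) (k r : ℕ) : ℂ :=
  ∏ i ∈ Finset.range k, (1 - q ^ (r + 1 + i))

lemma shiftedProd_succ (q : ℂ) (k r : ℕ) :
    shiftedProd q (k + 1) r = shiftedProd q k r * (1 - q ^ (r + 1 + k)) :=
  Finset.prod_range_succ _ _

lemma one_sub_mul_shiftedProd_succ (q : ℂ) (k r : ℕ) :
    (1 - q ^ (r + 1)) * shiftedProd q k (r + 1) = shiftedProd q k r * (1 - q ^ (r + 1 + k)) := by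
  rw [← shiftedProd_succ, shiftedProd, shiftedProd, Finset.prod_range_succ', mul_comm]
  congr 1
  exact Finset.prod_congr rfl fun i _ => by ring

lemma norm_shiftedProd_le_two_pow {q : ℂ} (hq : ‖q‖ ≤ 1) (k r : ℕ) :
    ‖shiftedProd q k r‖ ≤ 2 ^ k := by
  rw [shiftedProd, norm_prod]
  calc ∏ i ∈ Finset.range k, ‖1 - q ^ (r + 1 + i)‖ ≤ ∏ _i ∈ Finset.range k, (2 : ℝ) :=
        Finset.prod_le_prod (fun i _ => norm_nonneg _) fun i _ => norm_one_sub_pow_le_two hq _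
    _ = 2 ^ k := by simp

lemma norm_shiftedProd_le {q : ℂ} (hq : ‖q‖ < 1) (k r : ℕ) :
    ‖shiftedProd q k r‖ ≤ Real.exp (1 - ‖q‖)⁻¹ := by
  rw [shiftedProd, norm_prod]
  refine le_trans (Finset.prod_le_prod (fun i _ => norm_nonneg _) fun i _ => ?_)
    (prod_one_add_pow_le (norm_nonneg q) hq k)
  refine (norm_sub_le _ _).trans ?_
  rw [norm_one, norm_pow]
  gcongr 1 + ?_
  exact pow_le_pow_of_le_one (norm_nonneg q) hq.le (by omega)

/-- General term of `rrSum`. -/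
noncomputable def rrTerm (q : ℂ) (k r : ℕ) : ℂ :=
  (-1) ^ r * q ^ (2 * k * r + (5 * r.choose 2 + 3 * r)) * (1 - q ^ (2 * k + 2 + 4 * r)) *
    shiftedProd q k r

/-- `(q; q)_∞` times the function `∑_m q ^ (m ^ 2) x ^ m / (q; q)_m` at `x = q ^ k`, in the form
of the series of Rogers. -/
noncomputable def rrSum (q : ℂ) (k : ℕ) : ℂ := ∑' r : ℕ, rrTerm q k r

/-- General term of the companion series which links `rrSum q k` and `rrSum q (k + 1)`. -/
noncomputable def rrTerm' (q : ℂ) (k r : ℕ) : ℂ :=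
  (-1) ^ r * q ^ ((2 * k + 1) * r + (5 * r.choose 2 + 3 * r)) * (1 - q ^ (k + 1 + 2 * r)) *
    shiftedProd q k r

lemma norm_series_term_le {q : ℂ} {ρ C : ℝ} (hρ : ‖q‖ ≤ ρ) (hρ1 : ρ ≤ 1) {b c : ℂ}
    (hb : ‖b‖ ≤ 2) (hc : ‖c‖ ≤ C) (r e m : ℕ) :
    ‖(-1) ^ r * q ^ (e + (m + 3 * r)) * b * c‖ ≤ ρ ^ r * (2 * C) := by
  have h1 : ‖q‖ ^ (e + (m + 3 * r)) ≤ ρ ^ r :=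
    (pow_le_pow_left₀ (norm_nonneg q) hρ _).trans
      (pow_le_pow_of_le_one ((norm_nonneg q).trans hρ) hρ1 (by omega))
  have hρ0 : 0 ≤ ρ := (norm_nonneg q).trans hρ
  rw [norm_mul, norm_mul, norm_mul, norm_pow, norm_pow, norm_neg, norm_one, one_pow, one_mul,
    mul_assoc]
  gcongr

lemma norm_rrTerm_le {q : ℂ} {ρ : ℝ} (hρ : ‖q‖ ≤ ρ) (hρ1 : ρ ≤ 1) (k r : ℕ) :
    ‖rrTerm q k r‖ ≤ ρ ^ r * (2 * 2 ^ k) :=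
  norm_series_term_le hρ hρ1 (norm_one_sub_pow_le_two (hρ.trans hρ1) _)
    (norm_shiftedProd_le_two_pow (hρ.trans hρ1) k r) _ _ _

lemma summable_rrTerm {q : ℂ} (hq : ‖q‖ < 1) (k : ℕ) : Summable (rrTerm q k) :=
  Summable.of_norm_bounded ((summable_geometric_of_lt_one (norm_nonneg q) hq).mul_right _)
    fun r => norm_rrTerm_le le_rfl hq.le k r

lemma summable_rrTerm' {q : ℂ} (hq : ‖q‖ < 1) (k : ℕ) : Summable (rrTerm' q k) :=
  Summable.of_norm_bounded ((summable_geometric_of_lt_one (norm_nonneg q) hq).mul_right _)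
    fun r => norm_series_term_le le_rfl hq.le (norm_one_sub_pow_le_two hq.le _)
      (norm_shiftedProd_le_two_pow hq.le k r) _ _ _

lemma tsum_eq_of_sub_eq_sub_succ {f g d : ℕ → ℂ} (hf : Summable f) (hg : Summable g)
    (hd : Summable d) (h0 : d 0 = 0) (h : ∀ r, f r - g r = d r - d (r + 1)) :
    ∑' r, f r = ∑' r, g r := by
  have h1 := hd.tsum_eq_zero_add
  rw [h0, zero_add] at h1
  rw [← sub_eq_zero, ← hf.tsum_sub hg, tsum_congr h,
    hd.tsum_sub ((summable_nat_add_iff 1).2 hd), ← h1, sub_self]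

lemma choose_two_succ (r : ℕ) : (r + 1).choose 2 = r.choose 2 + r := by
  rw [Nat.choose_succ_succ' r 1, Nat.choose_one_right, add_comm]

lemma tsum_rrTerm' {q : ℂ} (hq : ‖q‖ < 1) (k : ℕ) :
    ∑' r, rrTerm' q k r = rrSum q (k + 1) := by
  refine tsum_eq_of_sub_eq_sub_succ
    (d := fun r => (-1) ^ r * q ^ ((2 * k + 1) * r + (5 * r.choose 2 + 3 * r)) * (1 - q ^ r) *
      shiftedProd q k r) (summable_rrTerm' hq k) (summable_rrTerm hq (k + 1)) ?_ (by simp)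
      fun r => ?_
  · exact Summable.of_norm_bounded ((summable_geometric_of_lt_one (norm_nonneg q) hq).mul_right _)
      fun r => norm_series_term_le le_rfl hq.le (norm_one_sub_pow_le_two hq.le _)
        (norm_shiftedProd_le_two_pow hq.le k r) _ _ _
  · simp only [rrTerm', rrTerm, shiftedProd_succ, choose_two_succ]
    linear_combination ((-1) ^ (r + 1) *
      q ^ ((2 * k + 1) * (r + 1) + (5 * (r.choose 2 + r) + 3 * (r + 1)))) *
        one_sub_mul_shiftedProd_succ q k r

lemma rrSum_eq_add {q : ℂ} (hq : ‖q‖ < 1) (k : ℕ) :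
    rrSum q k = rrSum q (k + 1) + q ^ (k + 1) * rrSum q (k + 2) := by
  rw [← tsum_rrTerm' hq k, ← tsum_rrTerm' hq (k + 1), ← tsum_mul_left,
    ← (summable_rrTerm' hq k).tsum_add ((summable_rrTerm' hq (k + 1)).mul_left _)]
  refine tsum_eq_of_sub_eq_sub_succ
    (d := fun r => (-1) ^ r * q ^ (2 * k * r + (5 * r.choose 2 + 3 * r)) * (1 - q ^ r) *
      shiftedProd q k r) (summable_rrTerm hq k)
    ((summable_rrTerm' hq k).add ((summable_rrTerm' hq (k + 1)).mul_left _)) ?_ (by simp)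
      fun r => ?_
  · exact Summable.of_norm_bounded ((summable_geometric_of_lt_one (norm_nonneg q) hq).mul_right _)
      fun r => norm_series_term_le le_rfl hq.le (norm_one_sub_pow_le_two hq.le _)
        (norm_shiftedProd_le_two_pow hq.le k r) _ _ _
  · simp only [rrTerm', rrTerm, shiftedProd_succ, choose_two_succ]
    linear_combination ((-1) ^ (r + 1) *
      q ^ (2 * k * (r + 1) + (5 * (r.choose 2 + r) + 3 * (r + 1)))) *
        one_sub_mul_shiftedProd_succ q k r

lemma tendsto_rrSum {q : ℂ} (hq : ‖q‖ < 1) : Tendsto (rrSum q) atTop (𝓝 (qPoch q q)) := by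
  have h0 : Tendsto (fun k : ℕ => q ^ k) atTop (𝓝 0) :=
    tendsto_pow_atTop_nhds_zero_of_norm_lt_one hq
  have key : Tendsto (fun k => ∑' r, rrTerm q k r) atTop
      (𝓝 (∑' r : ℕ, if r = 0 then qPoch q q else 0)) := by
    refine tendsto_tsum_of_dominated_convergence
      ((summable_geometric_of_lt_one (norm_nonneg q) hq).mul_right
        (2 * Real.exp (1 - ‖q‖)⁻¹)) (fun r => ?_) (Eventually.of_forall fun k r => ?_)
    · rcases Nat.eq_zero_or_pos r with rfl | hr
      · have h1 : Tendsto (fun k : ℕ => 1 - (q ^ k) ^ 2 * q ^ 2) atTop (𝓝 (1 - 0 ^ 2 * q ^ 2)) :=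
          ((h0.pow 2).mul_const _).const_sub 1
        have h2 := h1.mul (tendsto_qPoch hq q)
        simp only [ne_eq, OfNat.ofNat_ne_zero, not_false_eq_true, zero_pow, zero_mul, sub_zero,
          one_mul] at h2
        refine h2.congr fun k => ?_
        simp only [rrTerm, shiftedProd]
        congr 1
        · simp; ring
        · exact Finset.prod_congr rfl fun i _ => by ring
      · rw [if_neg hr.ne']
        refine squeeze_zero_norm (a := fun k => ‖q ^ k‖ * (2 * Real.exp (1 - ‖q‖)⁻¹)) (fun k => ?_)
          (by simpa using h0.norm.mul_const (2 * Real.exp (1 - ‖q‖)⁻¹))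
        rw [rrTerm, norm_mul, norm_mul, norm_mul, norm_pow, norm_pow, norm_pow, norm_neg, norm_one,
          one_pow, one_mul, mul_assoc]
        gcongr ?_ * (?_ * ?_)
        · exact pow_le_pow_of_le_one (norm_nonneg q) hq.le (by nlinarith)
        · exact norm_one_sub_pow_le_two hq.le _
        · exact norm_shiftedProd_le hq k r
    · exact norm_series_term_le le_rfl hq.le (norm_one_sub_pow_le_two hq.le _)
        (norm_shiftedProd_le hq k r) _ _ _
  rwa [tsum_ite_eq] at key

lemma thetaTerm_natCast {q z : ℂ} (hq : q ≠ 0) (hz : z ≠ 0) (n : ℕ) :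
    thetaTerm q z n = q ^ n.choose 2 * (-z) ^ n := by
  induction n with
  | zero => simp
  | succ n ih =>
    push_cast
    rw [thetaTerm_succ hq hz, ih, choose_two_succ, zpow_natCast]
    ring

lemma theta_eq_tsum_nat {q z : ℂ} (hq0 : q ≠ 0) (hq : ‖q‖ < 1) (hz : z ≠ 0) :
    theta q z = ∑' r : ℕ, (q ^ r.choose 2 * (-(q / z)) ^ r +
      q ^ (r + 1).choose 2 * (-z) ^ (r + 1)) := by
  have hqz : q / z ≠ 0 := div_ne_zero hq0 hz
  have hs : Summable (thetaTerm q (q / z)) := (summable_norm_thetaTerm hq0 hq hqz).of_norm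
  rw [← theta_div hq0, theta, tsum_of_nat_of_neg_add_one
    ((summable_thetaTerm_nat hq0 hq hqz).of_norm) ?_, ← Summable.tsum_add
    ((summable_thetaTerm_nat hq0 hq hqz).of_norm)]
  · refine tsum_congr fun r => ?_
    rw [thetaTerm_natCast hq0 hqz, thetaTerm_neg hq0, div_div_cancel₀ hq0]
    norm_cast
    rw [thetaTerm_natCast hq0 hz]
  all_goals
    refine hs.comp_injective (i := fun n : ℕ => -((n : ℤ) + 1)) fun a b h => ?_
    simp only at h
    omega

/-- The first Rogers–Ramanujan identity, with the theta series in place of the product. -/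
lemma rrSum_zero {q : ℂ} (hq0 : q ≠ 0) (hq : ‖q‖ < 1) : rrSum q 0 = theta (q ^ 5) (q ^ 2) := by
  have hq5 : ‖q ^ 5‖ < 1 := by rw [norm_pow]; exact pow_lt_one₀ (norm_nonneg q) hq (by norm_num)
  rw [theta_eq_tsum_nat (pow_ne_zero 5 hq0) hq5 (pow_ne_zero 2 hq0), rrSum]
  refine tsum_congr fun r => ?_
  rw [show q ^ 5 / q ^ 2 = q ^ 3 by field_simp, choose_two_succ, rrTerm, shiftedProd,
    Finset.prod_range_zero, neg_pow (q ^ 3), neg_pow (q ^ 2)]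
  ring

/-- The second Rogers–Ramanujan identity, with the theta series in place of the product. -/
lemma rrSum_one {q : ℂ} (hq0 : q ≠ 0) (hq : ‖q‖ < 1) : rrSum q 1 = theta (q ^ 5) q := by
  have hq5 : ‖q ^ 5‖ < 1 := by rw [norm_pow]; exact pow_lt_one₀ (norm_nonneg q) hq (by norm_num)
  rw [theta_eq_tsum_nat (pow_ne_zero 5 hq0) hq5 hq0, ← tsum_rrTerm' hq 0]
  refine tsum_congr fun r => ?_
  rw [show q ^ 5 / q = q ^ 4 by field_simp, choose_two_succ, rrTerm', shiftedProd,
    Finset.prod_range_zero, neg_pow (q ^ 4), neg_pow q]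
  ring

/-! ### The continued fraction -/

lemma rrContFract_get? (t : ℂ) (n : ℕ) :
    (rrContFract t).s.get? n = some ⟨if n = 0 then t else (t ^ 5) ^ n, 1⟩ := rfl

lemma rrContFract_contsAux_succ (t : ℂ) (n : ℕ) :
    (rrContFract t).contsAux (n + 3) =
      ⟨((rrContFract t).contsAux (n + 2)).a +
          (t ^ 5) ^ (n + 1) * ((rrContFract t).contsAux (n + 1)).a,
        ((rrContFract t).contsAux (n + 2)).b +
          (t ^ 5) ^ (n + 1) * ((rrContFract t).contsAux (n + 1)).b⟩ := by
  rw [GenContFract.contsAux_recurrence (rrContFract_get? t (n + 1)) rfl rfl]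
  simp

lemma rrContFract_contsAux_two (t : ℂ) : (rrContFract t).contsAux 2 = ⟨t, 1⟩ := by
  rw [GenContFract.contsAux_recurrence (rrContFract_get? t 0) rfl rfl]
  simp [rrContFract]

lemma rrContFract_contsAux_one (t : ℂ) : (rrContFract t).contsAux 1 = ⟨0, 1⟩ := rfl

/-- A sequence with `X (n + 2) = X (n + 1) + q ^ (n + 1) X n` converges when it has a constant
pairing with `rrSum q`, because `rrSum q` has the non-zero limit `(q; q)_∞`. -/
lemma tendsto_of_rrSum_pairing {q : ℂ} (hq : ‖q‖ < 1) {X : ℕ → ℂ}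
    (hX : ∀ n, X (n + 2) = X (n + 1) + q ^ (n + 1) * X n) :
    Tendsto X atTop (𝓝 ((X 1 * rrSum q 1 + q * X 0 * rrSum q 2) / qPoch q q)) := by
  have hpair : ∀ n, X (n + 1) * rrSum q (n + 1) + q ^ (n + 1) * X n * rrSum q (n + 2) =
      X 1 * rrSum q 1 + q * X 0 * rrSum q 2 := by
    intro n
    induction n with
    | zero => simp
    | succ n ih =>
      rw [hX]
      rw [rrSum_eq_add hq (n + 1)] at ih
      linear_combination ih
  obtain ⟨C, hC0, hC⟩ : ∃ C : ℝ, 0 ≤ C ∧ ∀ n, ‖X n‖ ≤ C := by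
    set M := max ‖X 0‖ ‖X 1‖ with hM
    have hM0 : 0 ≤ M := (norm_nonneg _).trans (le_max_left _ _)
    have h1 : ∀ n, ‖X n‖ ≤ M * ∏ i ∈ Finset.range (n + 1), (1 + ‖q‖ ^ i) ∧
        ‖X (n + 1)‖ ≤ M * ∏ i ∈ Finset.range (n + 1), (1 + ‖q‖ ^ i) := by
      intro n
      induction n with
      | zero =>
        simp only [zero_add, Finset.prod_range_one, pow_zero]
        constructor <;> nlinarith [le_max_left ‖X 0‖ ‖X 1‖, le_max_right ‖X 0‖ ‖X 1‖]
      | succ n ih =>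
        have hP : 0 ≤ ∏ i ∈ Finset.range (n + 1), (1 + ‖q‖ ^ i) :=
          Finset.prod_nonneg fun i _ => by positivity
        have hq1 : 0 ≤ ‖q‖ ^ (n + 1) := by positivity
        rw [Finset.prod_range_succ _ (n + 1)]
        refine ⟨ih.2.trans ?_, ?_⟩
        · nlinarith [mul_nonneg (mul_nonneg hM0 hP) hq1]
        · rw [hX]
          calc ‖X (n + 1) + q ^ (n + 1) * X n‖ ≤ ‖X (n + 1)‖ + ‖q‖ ^ (n + 1) * ‖X n‖ := by
                refine (norm_add_le _ _).trans ?_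
                rw [norm_mul, norm_pow]
            _ ≤ M * (∏ i ∈ Finset.range (n + 1), (1 + ‖q‖ ^ i)) + ‖q‖ ^ (n + 1) *
                (M * ∏ i ∈ Finset.range (n + 1), (1 + ‖q‖ ^ i)) := by
                gcongr
                exacts [ih.2, ih.1]
            _ = _ := by ring
    refine ⟨M * Real.exp (1 - ‖q‖)⁻¹, by positivity, fun n => (h1 n).1.trans ?_⟩
    gcongr
    exact prod_one_add_pow_le (norm_nonneg q) hq _
  have hF := tendsto_rrSum hq
  have hq0 : qPoch q q ≠ 0 := qPoch_ne_zero_of_norm_lt hq hq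
  have hpow : Tendsto (fun n : ℕ => q ^ (n + 1)) atTop (𝓝 0) :=
    (tendsto_pow_atTop_nhds_zero_of_norm_lt_one hq).comp (tendsto_add_atTop_nat 1)
  have hqX : Tendsto (fun n : ℕ => q ^ (n + 1) * X n) atTop (𝓝 0) := by
    refine squeeze_zero_norm (a := fun n => ‖q ^ (n + 1)‖ * C) (fun n => ?_)
      (by simpa using hpow.norm.mul_const C)
    rw [norm_mul]
    gcongr
    exact hC n
  set S := X 1 * rrSum q 1 + q * X 0 * rrSum q 2
  have h2 : Tendsto (fun n => (S - q ^ (n + 1) * X n * rrSum q (n + 2)) / rrSum q (n + 1)) atTop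
      (𝓝 ((S - 0 * qPoch q q) / qPoch q q)) :=
    ((hqX.mul (hF.comp (tendsto_add_atTop_nat 2))).const_sub S).div
      (hF.comp (tendsto_add_atTop_nat 1)) hq0
  rw [zero_mul, sub_zero] at h2
  rw [← tendsto_add_atTop_iff_nat 1]
  refine h2.congr' ?_
  filter_upwards [(hF.comp (tendsto_add_atTop_nat 1)).eventually_ne hq0] with n hn
  rw [← hpair n, add_sub_cancel_right]
  exact mul_div_cancel_right₀ _ hn

lemma rrSum_zero_ne_zero {q : ℂ} (hq : ‖q‖ < 1) : rrSum q 0 ≠ 0 := by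
  rcases eq_or_ne q 0 with rfl | hq0
  · rw [rrSum, tsum_eq_single 0 fun r hr => by simp [rrTerm, hr]]
    simp [rrTerm, shiftedProd]
  · rw [rrSum_zero hq0 hq]
    exact theta_pow_ne_zero hq0 hq (by norm_num) (by norm_num)

theorem tendsto_rrContFract_convs {t : ℂ} (ht : ‖t‖ < 1) :
    Tendsto (rrContFract t).convs atTop (𝓝 (t * rrSum (t ^ 5) 1 / rrSum (t ^ 5) 0)) := by
  have hq : ‖t ^ 5‖ < 1 := by rw [norm_pow]; exact pow_lt_one₀ (norm_nonneg t) ht (by norm_num)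
  have hP : qPoch (t ^ 5) (t ^ 5) ≠ 0 := qPoch_ne_zero_of_norm_lt hq hq
  have hA := tendsto_of_rrSum_pairing hq (X := fun n => ((rrContFract t).contsAux (n + 1)).a)
    fun n => by simp only [rrContFract_contsAux_succ]
  have hB := tendsto_of_rrSum_pairing hq (X := fun n => ((rrContFract t).contsAux (n + 1)).b)
    fun n => by simp only [rrContFract_contsAux_succ]
  simp only [zero_add, one_add_one_eq_two, rrContFract_contsAux_one, rrContFract_contsAux_two,
    mul_zero, zero_mul, add_zero, mul_one, one_mul] at hA hB
  have h0 := rrSum_eq_add hq 0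
  simp only [zero_add, pow_one] at h0
  rw [← h0] at hB
  have h := hA.div hB (div_ne_zero (rrSum_zero_ne_zero hq) hP)
  rwa [div_div_div_cancel_right₀ hP] at h

lemma rrR_eq {t : ℂ} (ht : ‖t‖ < 1) : rrR t = t * rrSum (t ^ 5) 1 / rrSum (t ^ 5) 0 :=
  (tendsto_rrContFract_convs ht).limUnder_eq

lemma rrR_eq_theta {t : ℂ} (ht0 : t ≠ 0) (ht : ‖t‖ < 1) :
    rrR t = t * theta ((t ^ 5) ^ 5) (t ^ 5) / theta ((t ^ 5) ^ 5) ((t ^ 5) ^ 2) := by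
  have hq : ‖t ^ 5‖ < 1 := by rw [norm_pow]; exact pow_lt_one₀ (norm_nonneg t) ht (by norm_num)
  rw [rrR_eq ht, rrSum_zero (pow_ne_zero 5 ht0) hq, rrSum_one (pow_ne_zero 5 ht0) hq]

lemma rrR_ne_zero {t : ℂ} (ht0 : t ≠ 0) (ht : ‖t‖ < 1) : rrR t ≠ 0 := by
  have hq0 : t ^ 5 ≠ 0 := pow_ne_zero 5 ht0
  have hq : ‖t ^ 5‖ < 1 := by rw [norm_pow]; exact pow_lt_one₀ (norm_nonneg t) ht (by norm_num)
  have h1 := theta_pow_ne_zero hq0 hq (k := 1) (N := 5) (by norm_num) (by norm_num)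
  rw [pow_one] at h1
  rw [rrR_eq_theta ht0 ht]
  exact div_ne_zero (mul_ne_zero ht0 h1)
    (theta_pow_ne_zero hq0 hq (k := 2) (N := 5) (by norm_num) (by norm_num))

/-! ### The modular equations of degrees two and three -/

lemma exists_sq_eq_of_norm_lt_one {q : ℂ} (hq0 : q ≠ 0) (hq : ‖q‖ < 1) :
    ∃ p : ℂ, p ^ 2 = q ∧ p ≠ 0 ∧ ‖p‖ < 1 := by
  obtain ⟨p, hp⟩ := IsAlgClosed.exists_pow_nat_eq q two_pos
  refine ⟨p, hp, fun h => hq0 (by rw [← hp, h]; simp), ?_⟩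
  rw [← hp, norm_pow] at hq
  exact (pow_lt_one_iff_of_nonneg (norm_nonneg p) two_ne_zero).1 hq

/-- `R(q)` as a quotient of theta values with nome `q ^ (5 N)`. -/
lemma rrR_eq_theta_prod {t : ℂ} (ht0 : t ≠ 0) (ht : ‖t‖ < 1) {N : ℕ} (hN : 0 < N) :
    rrR t = t * (∏ i ∈ Finset.range N, theta ((t ^ 5) ^ (5 * N)) ((t ^ 5) ^ (1 + 5 * i))) /
      ∏ i ∈ Finset.range N, theta ((t ^ 5) ^ (5 * N)) ((t ^ 5) ^ (2 + 5 * i)) := by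
  have hq0 : (t ^ 5) ^ 5 ≠ 0 := pow_ne_zero 5 (pow_ne_zero 5 ht0)
  have hq : ‖(t ^ 5) ^ 5‖ < 1 := by
    rw [← pow_mul, norm_pow]; exact pow_lt_one₀ (norm_nonneg t) ht (by norm_num)
  obtain ⟨K, hK, h⟩ := theta_eq_mul_prod hq0 hq hN
  rw [rrR_eq_theta ht0 ht, h _ (pow_ne_zero 5 ht0), h _ (pow_ne_zero 2 (pow_ne_zero 5 ht0)),
    mul_left_comm, mul_div_mul_left _ _ hK]
  congr 1
  · refine congrArg _ (Finset.prod_congr rfl fun i _ => ?_)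
    congr 1 <;> ring
  · refine Finset.prod_congr rfl fun i _ => ?_
    congr 1 <;> ring

/-- Rogers's modular equation of degree two. -/
theorem rrR_modular_two {t : ℂ} (ht0 : t ≠ 0) (ht : ‖t‖ < 1) :
    rrR (t ^ 2) - rrR t ^ 2 = rrR t * rrR (t ^ 2) ^ 2 * (rrR (t ^ 2) + rrR t ^ 2) := by
  have ht2 : ‖t ^ 2‖ < 1 := by rw [norm_pow]; exact pow_lt_one₀ (norm_nonneg t) ht two_ne_zero
  obtain ⟨p, hp, hp0, hp1⟩ := exists_sq_eq_of_norm_lt_one (pow_ne_zero 5 ht0)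
    (show ‖t ^ 5‖ < 1 by rw [norm_pow]; exact pow_lt_one₀ (norm_nonneg t) ht (by norm_num))
  have hu := rrR_eq_theta_prod ht0 ht (N := 2) (by norm_num)
  have hv := rrR_eq_theta_prod (pow_ne_zero 2 ht0) ht2 (N := 1) (by norm_num)
  have h6 := theta_pow_reflect hp0 (show 8 ≤ 20 by norm_num)
  have h7 := theta_pow_reflect hp0 (show 6 ≤ 20 by norm_num)
  have h8 := theta_pow_reflect hp0 (show 4 ≤ 20 by norm_num)
  -- the nome is `q ^ 10 = p ^ 20`; sums and differences of the four exponents are even, so only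
  -- the theta values `E1, …, E5` at `q, …, q ^ 5` occur
  have h1 := theta_three_term_pow hp0 hp1 (N := 20) (by norm_num) (a := 8) (b := 6) (c := 4)
    (d := 0) (by norm_num) (by norm_num) (by norm_num)
  have h2 := theta_three_term_pow hp0 hp1 (N := 20) (by norm_num) (a := 7) (b := 5) (c := 3)
    (d := 1) (by norm_num) (by norm_num) (by norm_num)
  have n1 := theta_pow_ne_zero hp0 hp1 (k := 2) (N := 20) (by norm_num) (by norm_num)
  have n2 := theta_pow_ne_zero hp0 hp1 (k := 4) (N := 20) (by norm_num) (by norm_num)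
  have n3 := theta_pow_ne_zero hp0 hp1 (k := 6) (N := 20) (by norm_num) (by norm_num)
  have n4 := theta_pow_ne_zero hp0 hp1 (k := 8) (N := 20) (by norm_num) (by norm_num)
  have e2 : (t ^ 2) ^ 5 = p ^ 4 := by rw [← pow_mul, mul_comm, pow_mul, ← hp, ← pow_mul]
  rw [← hp] at hu
  rw [e2] at hv
  norm_num [Finset.prod_range_succ, ← pow_mul] at hu hv h1 h2 h6 h7 h8
  rw [h6, h7] at hu
  rw [h7, h6] at h1
  rw [h6] at h2
  rw [hu, hv]
  generalize theta (p ^ 20) (p ^ 2) = E1 at *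
  generalize theta (p ^ 20) (p ^ 4) = E2 at *
  generalize theta (p ^ 20) (p ^ 6) = E3 at *
  generalize theta (p ^ 20) (p ^ 8) = E4 at *
  generalize theta (p ^ 20) (p ^ 10) = E5 at *
  have k1 : t ^ 5 * E1 * E2 ^ 2 * E3 - E2 * E3 ^ 2 * E4 + E1 * E4 ^ 2 * E5 = 0 :=
    mul_left_cancel₀ (pow_ne_zero 4 hp0) (by linear_combination h1 - p ^ 4 * E1 * E2 ^ 2 * E3 * hp)
  have k2 : t ^ 5 * E1 ^ 2 * E2 * E4 + E1 * E3 * E4 ^ 2 - E2 ^ 2 * E3 * E5 = 0 :=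
    mul_left_cancel₀ (pow_ne_zero 3 hp0) (by linear_combination h2 - p ^ 3 * E1 ^ 2 * E2 * E4 * hp)
  field_simp
  linear_combination (-E2 ^ 2 * E3) * k1 - E1 * E4 ^ 2 * k2

/-- Rogers's modular equation of degree three. -/
theorem rrR_modular_three {t : ℂ} (ht0 : t ≠ 0) (ht : ‖t‖ < 1) :
    (rrR (t ^ 3) - rrR t ^ 3) * (1 + rrR t * rrR (t ^ 3) ^ 3) =
      3 * rrR t ^ 2 * rrR (t ^ 3) ^ 2 := by
  have ht3 : ‖t ^ 3‖ < 1 := by rw [norm_pow]; exact pow_lt_one₀ (norm_nonneg t) ht three_ne_zero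
  obtain ⟨p, hp, hp0, hp1⟩ := exists_sq_eq_of_norm_lt_one (pow_ne_zero 5 ht0)
    (show ‖t ^ 5‖ < 1 by rw [norm_pow]; exact pow_lt_one₀ (norm_nonneg t) ht (by norm_num))
  have hu := rrR_eq_theta_prod ht0 ht (N := 3) (by norm_num)
  have hv := rrR_eq_theta_prod (pow_ne_zero 3 ht0) ht3 (N := 1) (by norm_num)
  have h8 := theta_pow_reflect hp0 (show 14 ≤ 30 by norm_num)
  have h9 := theta_pow_reflect hp0 (show 12 ≤ 30 by norm_num)
  have h10 := theta_pow_reflect hp0 (show 10 ≤ 30 by norm_num)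
  have h11 := theta_pow_reflect hp0 (show 8 ≤ 30 by norm_num)
  have h12 := theta_pow_reflect hp0 (show 6 ≤ 30 by norm_num)
  -- the nome is `q ^ 15 = p ^ 30`, and only the theta values `E1, …, E7` at `q, …, q ^ 7` occur
  have h1 := theta_three_term_pow hp0 hp1 (N := 30) (by norm_num) (a := 11) (b := 9) (c := 5)
    (d := 1) (by norm_num) (by norm_num) (by norm_num)
  have h2 := theta_three_term_pow hp0 hp1 (N := 30) (by norm_num) (a := 11) (b := 9) (c := 7)
    (d := 1) (by norm_num) (by norm_num) (by norm_num)
  have h3 := theta_three_term_pow hp0 hp1 (N := 30) (by norm_num) (a := 9) (b := 7) (c := 5)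
    (d := 1) (by norm_num) (by norm_num) (by norm_num)
  have h4 := theta_three_term_pow hp0 hp1 (N := 30) (by norm_num) (a := 10) (b := 8) (c := 6)
    (d := 2) (by norm_num) (by norm_num) (by norm_num)
  have n : ∀ k : ℕ, 0 < k → k < 30 → theta (p ^ 30) (p ^ k) ≠ 0 := fun k hk hk' =>
    theta_pow_ne_zero hp0 hp1 hk hk'
  have n1 := n 2 (by norm_num) (by norm_num)
  have n2 := n 4 (by norm_num) (by norm_num)
  have n3 := n 6 (by norm_num) (by norm_num)
  have n4 := n 8 (by norm_num) (by norm_num)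
  have n5 := n 10 (by norm_num) (by norm_num)
  have n6 := n 12 (by norm_num) (by norm_num)
  have n7 := n 14 (by norm_num) (by norm_num)
  clear n
  have e3 : (t ^ 3) ^ 5 = p ^ 6 := by rw [← pow_mul, mul_comm, pow_mul, ← hp, ← pow_mul]
  rw [← hp] at hu
  rw [e3] at hv
  norm_num [Finset.prod_range_succ, ← pow_mul] at hu hv h1 h2 h3 h4 h8 h9 h10 h11 h12
  simp only [h8, h9, h10, h11, h12] at hu h1 h2 h3 h4
  rw [hu, hv]
  generalize theta (p ^ 30) (p ^ 2) = E1 at *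
  generalize theta (p ^ 30) (p ^ 4) = E2 at *
  generalize theta (p ^ 30) (p ^ 6) = E3 at *
  generalize theta (p ^ 30) (p ^ 8) = E4 at *
  generalize theta (p ^ 30) (p ^ 10) = E5 at *
  generalize theta (p ^ 30) (p ^ 12) = E6 at *
  generalize theta (p ^ 30) (p ^ 14) = E7 at *
  -- the quotients `r`, `s` and `X` satisfy two relations; eliminating `X` gives the claim
  have hq0 : t ^ 5 ≠ 0 := pow_ne_zero 5 ht0
  have k1 : (t ^ 5) ^ 2 * (E1 * E2 * E3) - E3 * E4 * E7 + E2 * E6 * E7 = 0 :=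
    mul_left_cancel₀ (mul_ne_zero (pow_ne_zero 5 hp0) n5) (by rw [← hp]; linear_combination h1)
  have k2 : t ^ 5 * (E1 * E3 * E4) - E2 * E4 * E6 + E1 * E6 * E7 = 0 :=
    mul_left_cancel₀ (mul_ne_zero (pow_ne_zero 7 hp0) n5) (by rw [← hp]; linear_combination h2)
  have k3 : t ^ 5 * (E1 * E2 * E3 * E7) - E2 * E3 * E4 * E7 + E1 * E4 * E5 * E6 = 0 :=
    mul_left_cancel₀ (pow_ne_zero 5 hp0) (by rw [← hp]; linear_combination h3)
  have k4 : t ^ 5 * (E1 * E2 * E4 * E6) - E2 * E3 * E5 * E7 + E1 * E4 * E6 * E7 = 0 :=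
    mul_left_cancel₀ (pow_ne_zero 6 hp0) (by rw [← hp]; linear_combination h4)
  obtain ⟨r, hr⟩ : ∃ r, r = E2 / E1 := ⟨_, rfl⟩
  obtain ⟨s, hs⟩ : ∃ s, s = E7 / E4 := ⟨_, rfl⟩
  obtain ⟨X, hX⟩ : ∃ X, X = t ^ 5 * E1 / E7 := ⟨_, rfl⟩
  have hrs : r - s = t ^ 5 * E3 / E6 := by
    rw [hr, hs]; field_simp; linear_combination -k2
  have r0 : r ≠ 0 := by rw [hr]; exact div_ne_zero n2 n1
  have s0 : s ≠ 0 := by rw [hs]; exact div_ne_zero n7 n4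
  have d0 : r - s ≠ 0 := by rw [hrs]; exact div_ne_zero (mul_ne_zero hq0 n3) n6
  have a1 : r * s * X * (X * (r - s) + 1) = r - s := by
    rw [hrs, hr, hs, hX]; field_simp; linear_combination k1
  have a2 : r ^ 2 * s * (r - s) ^ 2 * (1 - s * X) = (t ^ 5) ^ 2 * (1 + r * X) := by
    have b1 : E5 / E7 * t ^ 5 = r * (1 - s * X) * (r - s) := by
      rw [hrs, hr, hs, hX]; field_simp; linear_combination k3
    have b2 : E5 / E7 * (r * s * (r - s)) = t ^ 5 * (1 + r * X) := by
      rw [hrs, hr, hs, hX]; field_simp; linear_combination -k4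
    linear_combination t ^ 5 * b2 - r * s * (r - s) * b1
  have a3 : (r ^ 2 - r * s + s ^ 2) * (r ^ 3 * s ^ 3 * (r - s) ^ 4 - (t ^ 5) ^ 4) =
      3 * (t ^ 5) ^ 2 * r ^ 2 * s ^ 2 * (r - s) ^ 3 := by
    obtain ⟨Q, hQ⟩ : ∃ Q, Q = (t ^ 5) ^ 2 := ⟨_, rfl⟩
    rw [show (t ^ 5) ^ 4 = Q ^ 2 by rw [hQ]; ring, ← hQ]
    rw [← hQ] at a2
    obtain ⟨W, hW⟩ : ∃ W, W = r ^ 2 * s * (r - s) ^ 2 := ⟨_, rfl⟩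
    rw [← hW] at a2
    refine mul_left_cancel₀ r0 ?_
    have h : (r ^ 2 - r * s + s ^ 2) * (s * W ^ 2 - r * Q ^ 2) = 3 * r * s * (r - s) * W * Q := by
      linear_combination (Q * r + s * W) ^ 2 * a1 +
        (r * s * (r - s) * (W - Q + X * (Q * r + s * W)) + r * s * (Q * r + s * W)) * a2
    rw [hW] at h
    linear_combination h
  have hu' : t * (E1 * E6 * E4) / (E2 * E7 * E3) = t ^ 6 / (r * s * (r - s)) := by
    rw [hrs, hr, hs]; field_simp
  have hw' : t ^ 3 * E3 / E6 = (r - s) / t ^ 2 := by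
    rw [hrs]; field_simp
  rw [hu', hw']
  field_simp
  linear_combination a3

/-! ### Analyticity on the unit disc -/

lemma rrR_zero : rrR 0 = 0 := by rw [rrR_eq (by simp), zero_mul, zero_div]

lemma differentiable_rrTerm (k r : ℕ) : Differentiable ℂ fun q => rrTerm q k r := by
  unfold rrTerm shiftedProd
  fun_prop

lemma differentiableAt_rrSum {q : ℂ} (hq : ‖q‖ < 1) (k : ℕ) :
    DifferentiableAt ℂ (fun q => rrSum q k) q := by
  obtain ⟨ρ, h1, h2⟩ := exists_between hq
  have hρ : 0 ≤ ρ := (norm_nonneg q).trans h1.le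
  have h : DifferentiableOn ℂ (fun q => rrSum q k) (Metric.ball 0 ρ) :=
    Complex.differentiableOn_tsum_of_summable_norm
      ((summable_geometric_of_lt_one hρ h2).mul_right (2 * 2 ^ k))
      (fun r => (differentiable_rrTerm k r).differentiableOn) Metric.isOpen_ball
      fun r w hw => norm_rrTerm_le (mem_ball_zero_iff.1 hw).le h2.le k r
  exact h.differentiableAt (Metric.isOpen_ball.mem_nhds (mem_ball_zero_iff.2 h1))

lemma differentiableAt_rrR {t : ℂ} (ht : ‖t‖ < 1) : DifferentiableAt ℂ rrR t := by
  have hq : ‖t ^ 5‖ < 1 := by rw [norm_pow]; exact pow_lt_one₀ (norm_nonneg t) ht (by norm_num)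
  have h : ∀ k, DifferentiableAt ℂ (fun t : ℂ => rrSum (t ^ 5) k) t := fun k =>
    (differentiableAt_rrSum hq k).comp t (differentiableAt_pow 5)
  refine ((differentiableAt_id.mul (h 1)).div (h 0)
    (rrSum_zero_ne_zero hq)).congr_of_eventuallyEq ?_
  filter_upwards [Metric.isOpen_ball.mem_nhds (mem_ball_zero_iff.2 ht)] with s hs
  exact rrR_eq (mem_ball_zero_iff.1 hs)

lemma differentiableOn_rrR_pow (n : ℕ) :
    DifferentiableOn ℂ (fun t => rrR (t ^ (n + 1))) (Metric.ball 0 1) := fun t ht => by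
  have hn : ‖t ^ (n + 1)‖ < 1 := by
    rw [norm_pow]; exact pow_lt_one₀ (norm_nonneg t) (mem_ball_zero_iff.1 ht) n.succ_ne_zero
  exact ((differentiableAt_rrR hn).comp t (differentiableAt_pow (n + 1))).differentiableWithinAt

/-- The analytic functions on the disc form a domain, so a factor which does not vanish at the
centre can be cancelled. -/
lemma eq_zero_of_mul_eq_zero_of_differentiableOn {f g : ℂ → ℂ}
    (hf : DifferentiableOn ℂ f (Metric.ball 0 1)) (hg : DifferentiableOn ℂ g (Metric.ball 0 1))
    (h0 : f 0 ≠ 0) (hfg : ∀ t : ℂ, ‖t‖ < 1 → f t * g t = 0) {t : ℂ} (ht : ‖t‖ < 1) : g t = 0 := by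
  rcases (hf.analyticOnNhd Metric.isOpen_ball).eq_zero_or_eq_zero_of_mul_eq_zero
    (hg.analyticOnNhd Metric.isOpen_ball) (fun s hs => hfg s (mem_ball_zero_iff.1 hs))
    (convex_ball (0 : ℂ) 1).isPreconnected with h | h
  · exact absurd (h 0 (by simp)) h0
  · exact h t (mem_ball_zero_iff.2 ht)

/-! ### Further modular relations -/

section relations

variable {u v w z x y : ℂ → ℂ}

/-- The relation between the values `u, v, x` of `R` at `q, q ^ 2, q ^ 4`. Modulo the modular
equations its product with `1 + u x` vanishes. -/
lemma relation_one_two_four (hu : DifferentiableOn ℂ u (Metric.ball 0 1))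
    (hv : DifferentiableOn ℂ v (Metric.ball 0 1)) (hx : DifferentiableOn ℂ x (Metric.ball 0 1))
    (hu0 : u 0 = 0)
    (huv : ∀ t : ℂ, ‖t‖ < 1 → v t - u t ^ 2 = u t * v t ^ 2 * (v t + u t ^ 2))
    (hvx : ∀ t : ℂ, ‖t‖ < 1 → x t - v t ^ 2 = v t * x t ^ 2 * (x t + v t ^ 2))
    {t : ℂ} (ht : ‖t‖ < 1) : u t * (x t ^ 2 + v t ^ 2 * x t + u t * v t) - x t = 0 := by
  refine eq_zero_of_mul_eq_zero_of_differentiableOn (f := fun t => 1 + u t * x t)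
    (g := fun t => u t * (x t ^ 2 + v t ^ 2 * x t + u t * v t) - x t) (by fun_prop) (by fun_prop)
    (by simp [hu0]) (fun s hs => ?_) ht
  have h1 := huv s hs
  have h2 := hvx s hs
  generalize u s = u, v s = v, x s = x at *
  linear_combination -(v + x^3 + v^2*x^2) * h1 - (1 - u*v^2 - u^3*v) * h2

/-- A relation between the values `u, v, w, z` at `q, q ^ 2, q ^ 3, q ^ 6`, derived
from the four modular equations which link them. -/
lemma relation_expressing_three (hu : DifferentiableOn ℂ u (Metric.ball 0 1))
    (hv : DifferentiableOn ℂ v (Metric.ball 0 1)) (hw : DifferentiableOn ℂ w (Metric.ball 0 1))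
    (hz : DifferentiableOn ℂ z (Metric.ball 0 1))
    (hu0 : u 0 = 0) (hw0 : w 0 = 0)
    (huv : ∀ t : ℂ, ‖t‖ < 1 → v t - u t ^ 2 = u t * v t ^ 2 * (v t + u t ^ 2))
    (hwz : ∀ t : ℂ, ‖t‖ < 1 → z t - w t ^ 2 = w t * z t ^ 2 * (z t + w t ^ 2))
    (huw : ∀ t : ℂ, ‖t‖ < 1 → (w t - u t ^ 3) * (1 + u t * w t ^ 3) = 3 * u t ^ 2 * w t ^ 2)
    (hvz : ∀ t : ℂ, ‖t‖ < 1 → (z t - v t ^ 3) * (1 + v t * z t ^ 3) = 3 * v t ^ 2 * z t ^ 2)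
    {t : ℂ} (ht : ‖t‖ < 1) :
    u t * v t + v t * w t ^ 2 - v t ^ 2 * w t * z t + u t * w t ^ 2 * z t - w t = 0 := by
  refine eq_zero_of_mul_eq_zero_of_differentiableOn
    (f := fun t => 1 - (-w t * z t ^ 2 + 5 * u t * v t * z t ^ 2 + u t * v t ^ 2
      - u t * v t ^ 2 * w t * z t ^ 2 + 4 * u t ^ 2 * z t ^ 3 + 4 * u t ^ 2 * w t
      + 4 * u t ^ 2 * w t ^ 2 * z t ^ 2 - 2 * u t ^ 2 * v t * z t + u t ^ 3 * z t ^ 2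
      + u t ^ 3 * v t + u t ^ 3 * v t * w t * z t ^ 2))
    (g := fun t => u t * v t + v t * w t ^ 2 - v t ^ 2 * w t * z t + u t * w t ^ 2 * z t - w t)
    (by fun_prop) (by fun_prop) (by simp [hu0, hw0]) (fun s hs => ?_) ht
  have h1 := huv s hs
  have h2 := hwz s hs
  have h3 := huw s hs
  have h4 := hvz s hs
  generalize u s = u, v s = v, w s = w, z s = z at *
  linear_combination
    (-2*z - 2*w*z^3 + w^2 + w^3*z^2 - v*w*z - v*w^2*z^3 + u + 4*u*w*z^2 + u*v*w
      + u*v^2*w*z^3) * h1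
    + (2*v - u*w^2 + 2*u*v*w*z + 2*u*v*w^3 - 2*u*v^3 - 2*u^2 - 2*u^2*v*w - 5*u^2*v^2*z
      + 4*u^3*w*z + u^4*w - u^4*v*z - 2*u^4*v*w^2) * h2
    + (-1 - w*z^2 + 4*v*z^3 + 2*v*w + 2*v*w^2*z^2) * h3
    + (2*u*w^2 - u^2*v*w - u^4*w) * h4

lemma relation_expressing_two_sq (hu : DifferentiableOn ℂ u (Metric.ball 0 1))
    (hv : DifferentiableOn ℂ v (Metric.ball 0 1)) (hw : DifferentiableOn ℂ w (Metric.ball 0 1))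
    (hz : DifferentiableOn ℂ z (Metric.ball 0 1)) (hu0 : u 0 = 0)
    (huv : ∀ t : ℂ, ‖t‖ < 1 → v t - u t ^ 2 = u t * v t ^ 2 * (v t + u t ^ 2))
    (hwz : ∀ t : ℂ, ‖t‖ < 1 → z t - w t ^ 2 = w t * z t ^ 2 * (z t + w t ^ 2))
    (h : ∀ t : ℂ, ‖t‖ < 1 →
      u t * v t + v t * w t ^ 2 - v t ^ 2 * w t * z t + u t * w t ^ 2 * z t - w t = 0)
    {t : ℂ} (ht : ‖t‖ < 1) :
    v t ^ 2 - u t * w t - u t * v t * z t + v t * w t ^ 2 * z t + u t * v t ^ 2 * w t * z t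
      = 0 := by
  refine eq_zero_of_mul_eq_zero_of_differentiableOn
    (f := fun t => 1 - (u t * v t * z t ^ 2 + u t * v t * w t ^ 2 * z t + u t * v t ^ 2))
    (g := fun t => v t ^ 2 - u t * w t - u t * v t * z t + v t * w t ^ 2 * z t
      + u t * v t ^ 2 * w t * z t)
    (by fun_prop) (by fun_prop) (by simp [hu0]) (fun s hs => ?_) ht
  have h1 := huv s hs
  have h2 := hwz s hs
  have h3 := h s hs
  generalize u s = u, v s = v, w s = w, z s = z at *
  linear_combination (w^2*z + v) * h1
    + (-u*v + 2*u*v^2*w - u*v^3*z + u^2*v*w*z + u^2*v^3) * h2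
    + (u + u*v*z^3 + 2*u*v*w + u*v*w^2*z^2 + u^2*v^2) * h3

/-- The relation for `1 / (v w) + v w` in terms of `u / z + z / u`, cleared of denominators. -/
lemma relation_reciprocal_sum (hu : DifferentiableOn ℂ u (Metric.ball 0 1))
    (hv : DifferentiableOn ℂ v (Metric.ball 0 1)) (hw : DifferentiableOn ℂ w (Metric.ball 0 1))
    (hz : DifferentiableOn ℂ z (Metric.ball 0 1)) (hu0 : u 0 = 0) (hw0 : w 0 = 0)
    (huv : ∀ t : ℂ, ‖t‖ < 1 → v t - u t ^ 2 = u t * v t ^ 2 * (v t + u t ^ 2))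
    (hwz : ∀ t : ℂ, ‖t‖ < 1 → z t - w t ^ 2 = w t * z t ^ 2 * (z t + w t ^ 2))
    (h1 : ∀ t : ℂ, ‖t‖ < 1 →
      u t * v t + v t * w t ^ 2 - v t ^ 2 * w t * z t + u t * w t ^ 2 * z t - w t = 0)
    (h2 : ∀ t : ℂ, ‖t‖ < 1 →
      v t ^ 2 - u t * w t - u t * v t * z t + v t * w t ^ 2 * z t + u t * v t ^ 2 * w t * z t = 0)
    {t : ℂ} (ht : ‖t‖ < 1) :
    u t * z t + u t * z t * v t ^ 2 * w t ^ 2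
      - v t * w t * (u t * z t + u t ^ 2 + z t ^ 2) = 0 := by
  refine eq_zero_of_mul_eq_zero_of_differentiableOn
    (f := fun t => 1 - (w t * z t ^ 2 - v t * w t - u t * v t ^ 2))
    (g := fun t => u t * z t + u t * z t * v t ^ 2 * w t ^ 2
      - v t * w t * (u t * z t + u t ^ 2 + z t ^ 2))
    (by fun_prop) (by fun_prop) (by simp [hu0, hw0]) (fun s hs => ?_) ht
  have h1 := h1 s hs
  have h2 := h2 s hs
  have h3 := huv s hs
  have h4 := hwz s hs
  generalize u s = u, v s = v, w s = w, z s = z at *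
  linear_combination v*w * h3 + (-v*w*z + u) * h4 + u*v*z * h1
    + (-w - w^2*z^2 + u*v^2*w) * h2

end relations

/-- The relation which is linear in the value `z` at `q ^ 6`. -/
lemma relation_expressing_six {u v w z : ℂ}
    (huv : v - u ^ 2 = u * v ^ 2 * (v + u ^ 2))
    (h1 : u * v + v * w ^ 2 - v ^ 2 * w * z + u * w ^ 2 * z - w = 0)
    (h2 : v ^ 2 - u * w - u * v * z + v * w ^ 2 * z + u * v ^ 2 * w * z = 0) :
    z * (u ^ 2 * w - v * w + u ^ 3 * v) - u * v ^ 2 * w * (u * v - w + u ^ 3) = 0 := by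
  linear_combination (-w * z + u * w) * huv + u * v * h1 - u ^ 2 * h2

lemma relation_mul_sub_sq_mul_sq {u v w z : ℂ}
    (huv : v - u ^ 2 = u * v ^ 2 * (v + u ^ 2))
    (hwz : z - w ^ 2 = w * z ^ 2 * (z + w ^ 2))
    (h2 : v ^ 2 - u * w - u * v * z + v * w ^ 2 * z + u * v ^ 2 * w * z = 0)
    (h3 : u * z + u * z * v ^ 2 * w ^ 2 - v * w * (u * z + u ^ 2 + z ^ 2) = 0) :
    v * z - u ^ 2 * w ^ 2 - u * z * (1 - v * w) * (z + w ^ 2) = 0 := by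
  linear_combination w ^ 2 * huv + v * hwz + u * v * w ^ 2 * h2 + (-z - w ^ 2 - u * v * w) * h3

/-- The relation between the values at `q, q ^ 2, q ^ 3, q ^ 6, q ^ 4, q ^ 12` . The
hypotheses are the preceding relations for `(u, v, w, z)` and for `(v, x, z, y)`; the coefficients
solve a linear system over the monomials of degree at most nine. -/
lemma relation_up_to_twelve {u v w z x y : ℂ}
    (huv : v - u ^ 2 = u * v ^ 2 * (v + u ^ 2))
    (hwz : z - w ^ 2 = w * z ^ 2 * (z + w ^ 2))
    (hvx : x - v ^ 2 = v * x ^ 2 * (x + v ^ 2))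
    (hzy : y - z ^ 2 = z * y ^ 2 * (y + z ^ 2))
    (hq1 : u * (x ^ 2 + v ^ 2 * x + u * v) - x = 0)
    (hq2 : w * (y ^ 2 + z ^ 2 * y + w * z) - y = 0)
    (hL1 : u * v + v * w ^ 2 - v ^ 2 * w * z + u * w ^ 2 * z - w = 0)
    (hL1b : v * x + x * z ^ 2 - x ^ 2 * z * y + v * z ^ 2 * y - z = 0)
    (hL2 : v ^ 2 - u * w - u * v * z + v * w ^ 2 * z + u * v ^ 2 * w * z = 0)
    (hL2b : x ^ 2 - v * z - v * x * y + x * z ^ 2 * y + v * x ^ 2 * z * y = 0)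
    (hi1 : u * z + u * z * v ^ 2 * w ^ 2 - v * w * (u * z + u ^ 2 + z ^ 2) = 0)
    (hi1b : v * y + v * y * x ^ 2 * z ^ 2 - x * z * (v * y + v ^ 2 + y ^ 2) = 0)
    (hi4 : v * z - u ^ 2 * w ^ 2 - u * z * (1 - v * w) * (z + w ^ 2) = 0)
    (hi4b : x * y - v ^ 2 * z ^ 2 - v * y * (1 - x * z) * (y + z ^ 2) = 0) :
    u ^ 2 * w ^ 2 * v * z + x * y - u * w * (1 + v * x * y ^ 2) * (y + z ^ 2) = 0 := by
  linear_combination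
    ((4/5)*w^2*z*y - v*w*x - (2/5)*v*w^2*z - (3/5)*u*w) * huv
    + (-3/5 + (2/5)*v*x^2 + (3/5)*v*w - (3/5)*v^2*z + (3/5)*u*x + (3/5)*u*w*z + (14/5)*u*v*y)
      * hwz
    + (-2/5*y + (2/5)*z*x*y - u*z - (1/5)*u*w*z*y) * hvx
    + (-(3/5)*x - (2/5)*v*x^3 + (1/5)*v*w*x + (2/5)*v^2 - (2/5)*v^3*w + u*x^2 + u*w - u*v*z +
      (4/5)*u*v*w^2 + (4/5)*u*v^2*x) * hzy
    + (-y - (4/5)*w*y^2 - (1/5)*w*x - (1/5)*w^2*z - (3/5)*v - (3/5)*v*z*x + (1/5)*v*w*y -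
      v*w*z^2 - (3/5)*v*w^3*z - v^2*w + u*z + (3/5)*u*w^2 - (2/5)*u*v*w*z - u^2*v*w) * hq1
    + (-2/5*v*y + (2/5)*v*z*x*y + (2/5)*v*w*x + (6/5)*v^2 - (4/5)*v^2*z*x - (4/5)*v^2*w*y +
      (2/5)*v^3*z*y + (2/5)*u*x^2 + u*z*y + (2/5)*u*w*z*x - u*v*x*y + (2/5)*u*v*z +
      (4/5)*u*v^2*x + (4/5)*u^2*v) * hq2
    + (-2/5*x*y^2 - (1/5)*x^2 - (2/5)*z^2*x*y + (3/5)*z^3 + (3/5)*w + (1/5)*w*z*x +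
      (3/5)*w^2*z^2 + (4/5)*v*y^3 + v*x*y + (2/5)*v*z + (4/5)*v*z^2*y^2 + v*w*z*y -
      (3/5)*v^2*x + (9/5)*u*y) * hL1
    + (-3/5 + (2/5)*v*x*y^2 - (2/5)*v*x^2 + (2/5)*v*z^2*x*y + (3/5)*v*w - (2/5)*v*w^2*y -
      (2/5)*v^2*z + (3/5)*v^2*w^2 - u*y^2 - u*z^2*y + (3/5)*u*w*z + (2/5)*u*v*y +
      (2/5)*u*v*w*x + (4/5)*u*v^2 - (2/5)*u*v^2*w*y) * hL1b
    + ((1/5)*y - (2/5)*x^2*y^2 - (3/5)*z*x*y - (6/5)*w*x + (2/5)*w*z*x^2 + (2/5)*v*z*y^2 -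
      (1/5)*v*w*y + (3/5)*u*z + u*w*x^2 + (4/5)*u*w*z*y + (2/5)*u*v*x - (3/5)*u*v*w*z +
      (3/5)*u^2 + (4/5)*u^2*w*y) * hL2
    + (-2/5*w - v*z + v*w*z*y + (3/5)*v*w^2 + (2/5)*v^2*x - (3/5)*v^2*w*z + (2/5)*u*y + u*z^2
      + (1/5)*u*w*x + (4/5)*u*v - (2/5)*u*v*z*x - (1/5)*u*v^2*w) * hL2b
    + ((7/5)*x - (2/5)*z*x^2 + v*y - (2/5)*v*w*x - (2/5)*v^2 - u*x^2 - (4/5)*u*z*y + (3/5)*u*w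
      + (3/5)*u*v*z - (2/5)*u^2*v) * hi1
    + ((3/5)*y + (3/5)*z^2 + (1/5)*v - v*w*y + (3/5)*v^2*w - (3/5)*u*z + (2/5)*u*v*x) * hi1b
    + (-2/5*x^2 + z*y + (3/5)*v*z + v^2*x - (4/5)*u*y) * hi4
    + (1 - z*x - (6/5)*w*y - (2/5)*v*z*y + v*w + (4/5)*u*v*y) * hi4b

/-! ### The relations for the continued fraction -/

lemma norm_pow_lt_one {t : ℂ} (ht : ‖t‖ < 1) {n : ℕ} (hn : n ≠ 0) : ‖t ^ n‖ < 1 := by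
  rw [norm_pow]
  exact pow_lt_one₀ (norm_nonneg t) ht hn

lemma rrR_modular_two_pow {t : ℂ} (ht : ‖t‖ < 1) (n : ℕ) (hn : n ≠ 0) :
    rrR (t ^ (n * 2)) - rrR (t ^ n) ^ 2 =
      rrR (t ^ n) * rrR (t ^ (n * 2)) ^ 2 * (rrR (t ^ (n * 2)) + rrR (t ^ n) ^ 2) := by
  rcases eq_or_ne t 0 with rfl | ht0
  · simp [hn, rrR_zero]
  · rw [pow_mul]
    exact rrR_modular_two (pow_ne_zero n ht0) (norm_pow_lt_one ht hn)

lemma rrR_modular_three_pow {t : ℂ} (ht : ‖t‖ < 1) (n : ℕ) (hn : n ≠ 0) :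
    (rrR (t ^ (n * 3)) - rrR (t ^ n) ^ 3) * (1 + rrR (t ^ n) * rrR (t ^ (n * 3)) ^ 3) =
      3 * rrR (t ^ n) ^ 2 * rrR (t ^ (n * 3)) ^ 2 := by
  rcases eq_or_ne t 0 with rfl | ht0
  · simp [hn, rrR_zero]
  · rw [pow_mul]
    exact rrR_modular_three (pow_ne_zero n ht0) (norm_pow_lt_one ht hn)

lemma rrR_one_two_four {t : ℂ} (ht : ‖t‖ < 1) (n : ℕ) (hn : n ≠ 0) :
    rrR (t ^ n) * (rrR (t ^ (n * 4)) ^ 2 + rrR (t ^ (n * 2)) ^ 2 * rrR (t ^ (n * 4))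
      + rrR (t ^ n) * rrR (t ^ (n * 2))) - rrR (t ^ (n * 4)) = 0 := by
  have h := relation_one_two_four (differentiableOn_rrR_pow 0) (differentiableOn_rrR_pow 1)
    (differentiableOn_rrR_pow 3) (by simp [rrR_zero])
    (fun s hs => rrR_modular_two_pow hs 1 one_ne_zero)
    (fun s hs => rrR_modular_two_pow hs 2 two_ne_zero) (norm_pow_lt_one ht hn)
  simpa only [← pow_mul, zero_add, mul_one, Nat.reduceAdd] using h

/-- The relations between `R(q)`, `R(q ^ 2)`, `R(q ^ 3)` and `R(q ^ 6)`. -/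
lemma rrR_one_two_three_six {t : ℂ} (ht : ‖t‖ < 1) (n : ℕ) (hn : n ≠ 0) :
    let u := rrR (t ^ n)
    let v := rrR (t ^ (n * 2))
    let w := rrR (t ^ (n * 3))
    let z := rrR (t ^ (n * 6))
    (u * v + v * w ^ 2 - v ^ 2 * w * z + u * w ^ 2 * z - w = 0) ∧
    (v ^ 2 - u * w - u * v * z + v * w ^ 2 * z + u * v ^ 2 * w * z = 0) ∧
    (u * z + u * z * v ^ 2 * w ^ 2 - v * w * (u * z + u ^ 2 + z ^ 2) = 0) := by
  have h1 : ∀ s : ℂ, ‖s‖ < 1 → _ := fun s hs =>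
    relation_expressing_three (differentiableOn_rrR_pow 0) (differentiableOn_rrR_pow 1)
      (differentiableOn_rrR_pow 2) (differentiableOn_rrR_pow 5) (by simp [rrR_zero])
      (by simp [rrR_zero])
      (fun s hs => rrR_modular_two_pow hs 1 one_ne_zero)
      (fun s hs => rrR_modular_two_pow hs 3 three_ne_zero)
      (fun s hs => rrR_modular_three_pow hs 1 one_ne_zero)
      (fun s hs => rrR_modular_three_pow hs 2 two_ne_zero) hs
  have h2 : ∀ s : ℂ, ‖s‖ < 1 → _ := fun s hs =>
    relation_expressing_two_sq (differentiableOn_rrR_pow 0) (differentiableOn_rrR_pow 1)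
      (differentiableOn_rrR_pow 2) (differentiableOn_rrR_pow 5) (by simp [rrR_zero])
      (fun s hs => rrR_modular_two_pow hs 1 one_ne_zero)
      (fun s hs => rrR_modular_two_pow hs 3 three_ne_zero) h1 hs
  have h3 := relation_reciprocal_sum (differentiableOn_rrR_pow 0)
      (differentiableOn_rrR_pow 1) (differentiableOn_rrR_pow 2) (differentiableOn_rrR_pow 5)
      (by simp [rrR_zero]) (by simp [rrR_zero])
      (fun s hs => rrR_modular_two_pow hs 1 one_ne_zero)
      (fun s hs => rrR_modular_two_pow hs 3 three_ne_zero) h1 h2 (norm_pow_lt_one ht hn)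
  have h1 := h1 _ (norm_pow_lt_one ht hn)
  have h2 := h2 _ (norm_pow_lt_one ht hn)
  simp only [← pow_mul, zero_add, mul_one, Nat.reduceAdd] at h1 h2 h3
  exact ⟨h1, h2, h3⟩

/-! ### Values which the parameter avoids -/

/-- The quartic `(1 - 4 k - k ^ 2) (1 + k - k ^ 2)` in the parameter `k = R(q) R(q ^ 2) ^ 2`, which
parametrizes `R(q) ^ 5` and `R(q ^ 2) ^ 5` rationally. It vanishes exactly when
`1 / R ^ 5 - 11 - R ^ 5` does, at `q` and equivalently at `q ^ 2`. -/
noncomputable def rrParamQuartic (k : ℂ) : ℂ := (1 - 4 * k - k ^ 2) * (1 + k - k ^ 2)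

/-- A zero of the quartic at `k = u v ^ 2` forces `v ^ 10 + 11 v ^ 5 = 1`, which is a statement
about the parameter `v x ^ 2` of the next level as well. -/
lemma rrParamQuartic_step {u v x : ℂ} (hu : u ≠ 0) (hv : v ≠ 0)
    (huv : v - u ^ 2 = u * v ^ 2 * (v + u ^ 2)) (hvx : x - v ^ 2 = v * x ^ 2 * (x + v ^ 2))
    (h : rrParamQuartic (u * v ^ 2) = 0) : rrParamQuartic (v * x ^ 2) = 0 := by
  unfold rrParamQuartic at *
  have h1 : v ^ 5 * (1 - u * v ^ 2) = (u * v ^ 2) ^ 2 * (1 + u * v ^ 2) := by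
    linear_combination v ^ 4 * huv
  have h2 : v ^ 5 * (1 + v * x ^ 2) ^ 2 = v * x ^ 2 * (1 - v * x ^ 2) ^ 2 := by
    have : x * (1 - v * x ^ 2) = v ^ 2 * (1 + v * x ^ 2) := by linear_combination hvx
    linear_combination -v * (x * (1 - v * x ^ 2) + v ^ 2 * (1 + v * x ^ 2)) * this
  have hk0 : u * v ^ 2 ≠ 0 := mul_ne_zero hu (pow_ne_zero 2 hv)
  generalize u * v ^ 2 = k at *
  generalize v * x ^ 2 = l at *
  generalize v ^ 5 = V at *
  have hk1 : 1 - k ≠ 0 := fun hk => by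
    have : k = 1 := by linear_combination -hk
    subst this
    norm_num at h1
  have hV : V ^ 2 + 11 * V - 1 = 0 := by
    refine (mul_eq_zero.1 (?_ : (1 - k) ^ 2 * _ = 0)).resolve_left (pow_ne_zero 2 hk1)
    linear_combination (V * (1 - k) + k ^ 2 * (1 + k) + 11 * (1 - k)) * h1
      - (1 + k - k ^ 2) * h
  have : ((1 - 4 * l - l ^ 2) * (1 + l - l ^ 2)) ^ 2 = 0 := by
    linear_combination -(1 + l - l ^ 2) * (1 + l) ^ 4 * hV
      + (1 + l - l ^ 2) * (V * (1 + l) ^ 2 + l * (1 - l) ^ 2 + 11 * (1 + l) ^ 2) * h2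
  exact pow_eq_zero_iff two_ne_zero |>.1 this

lemma rrParamQuartic_ne_zero {t : ℂ} (ht0 : t ≠ 0) (ht : ‖t‖ < 1) :
    rrParamQuartic (rrR t * rrR (t ^ 2) ^ 2) ≠ 0 := by
  intro h
  have hzero : ∀ n : ℕ, rrParamQuartic (rrR (t ^ 2 ^ n) * rrR ((t ^ 2 ^ n) ^ 2) ^ 2) = 0 := by
    intro n
    induction n with
    | zero => simpa using h
    | succ n ih =>
      have hs0 : t ^ 2 ^ n ≠ 0 := pow_ne_zero _ ht0
      have hs : ‖t ^ 2 ^ n‖ < 1 := norm_pow_lt_one ht (by positivity)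
      have hs0' := pow_ne_zero 2 hs0
      have hs' := norm_pow_lt_one hs two_ne_zero
      rw [pow_succ 2 n, pow_mul]
      exact rrParamQuartic_step (rrR_ne_zero hs0 hs) (rrR_ne_zero hs0' hs')
        (rrR_modular_two hs0 hs) (rrR_modular_two hs0' hs') ih
  have hcont : ContinuousAt (fun s => rrParamQuartic (rrR s * rrR (s ^ 2) ^ 2)) 0 := by
    have h1 : ContinuousAt rrR 0 := (differentiableAt_rrR (by simp)).continuousAt
    have h2 : ContinuousAt (fun s : ℂ => rrR (s ^ 2)) 0 :=
      ContinuousAt.comp' (g := rrR) (f := fun s : ℂ => s ^ 2)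
        (by rwa [zero_pow two_ne_zero]) (continuousAt_pow 0 2)
    unfold rrParamQuartic
    fun_prop
  have hlim : Tendsto (fun n : ℕ => t ^ 2 ^ n) atTop (𝓝 0) :=
    (tendsto_pow_atTop_nhds_zero_of_norm_lt_one ht).comp
      (tendsto_pow_atTop_atTop_of_one_lt one_lt_two)
  have := tendsto_nhds_unique ((hcont.tendsto.comp hlim).congr hzero) tendsto_const_nhds
  simp [rrParamQuartic, rrR_zero] at this

/-! ### Elimination -/

/-- For `c, d, e` the values at `q, q ^ 2, q ^ 4`. -/
lemma add_sq_mul_add_sq {c d e : ℂ} (hc : c ≠ 0) (hcd : d - c ^ 2 = c * d ^ 2 * (d + c ^ 2))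
    (hcde : c * (e ^ 2 + d ^ 2 * e + c * d) - e = 0) :
    (d + c ^ 2) * (c * d + e ^ 2) = 2 * c * e := by
  refine mul_left_cancel₀ hc ?_
  linear_combination (d + c ^ 2) * hcde + e * hcd

/-- For `a, b, c, d, e` the values at `q, q ^ 2, q ^ 4, q ^ 8, q ^ 16`. The identity is the product
of `c - a ^ 2 b = a (1 - b d) (d + c ^ 2)` and `(d + c ^ 2) (c d + e ^ 2) = 2 c e`. -/
lemma cleared_identity_up_to_sixteen {a b c d e : ℂ}
    (habc : a * (c ^ 2 + b ^ 2 * c + a * b) - c = 0)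
    (hbcd : b * (d ^ 2 + c ^ 2 * d + b * c) - d = 0)
    (hF : (d + c ^ 2) * (c * d + e ^ 2) = 2 * c * e) :
    b * (a ^ 2 * c * d - 2 * a * c * d * e + a ^ 2 * e ^ 2) =
      c ^ 2 * d - 2 * a * c * e + c * e ^ 2 := by
  linear_combination (c * d + e ^ 2) * habc - a * (c * d + e ^ 2) * hbcd - a * (1 - b * d) * hF

lemma denom_ne_zero_up_to_sixteen {a b c d e : ℂ}
    (ha : a ≠ 0) (hb : b ≠ 0) (hc : c ≠ 0) (he : e ≠ 0)
    (hab : b - a ^ 2 = a * b ^ 2 * (b + a ^ 2))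
    (habc : a * (c ^ 2 + b ^ 2 * c + a * b) - c = 0)
    (hbcd : b * (d ^ 2 + c ^ 2 * d + b * c) - d = 0)
    (hF : (d + c ^ 2) * (c * d + e ^ 2) = 2 * c * e) (hg : rrParamQuartic (a * b ^ 2) ≠ 0) :
    a ^ 2 * c * d - 2 * a * c * d * e + a ^ 2 * e ^ 2 ≠ 0 := by
  intro h
  have hid := cleared_identity_up_to_sixteen habc hbcd hF
  have h1 : a * (c * d + e ^ 2) = 2 * c * d * e := by
    refine mul_left_cancel₀ ha ?_
    linear_combination h
  have h2 : a = d * (d + c ^ 2) := by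
    refine mul_left_cancel₀ (mul_ne_zero (mul_ne_zero two_ne_zero hc) he) ?_
    linear_combination (d + c ^ 2) * h1 - a * hF
  have h3 : c * d + e ^ 2 = 2 * a * e := by
    refine mul_left_cancel₀ hc ?_
    linear_combination b * h - hid
  have h4 : c = a * (d + c ^ 2) := by
    refine mul_left_cancel₀ (mul_ne_zero two_ne_zero he) ?_
    linear_combination (d + c ^ 2) * h3 - hF
  have h5 : d = a * b + b ^ 2 * c := by
    linear_combination -hbcd - b * h2
  have h6 : a ^ 2 = c * d := by
    refine mul_left_cancel₀ (fun h0 => ha (by rw [h2, h0, mul_zero]) : d + c ^ 2 ≠ 0) ?_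
    linear_combination c * h2 - a * h4
  -- `s = b c / a` turns out to be a root of `s ^ 2 + s = 1`, and rational in `k = a b ^ 2`
  obtain ⟨s, hs⟩ : ∃ s, a * s = b * c := ⟨b * c / a, by field_simp⟩
  have h7 : s ^ 2 + s = 1 := by
    refine mul_left_cancel₀ (pow_ne_zero 2 ha) ?_
    linear_combination (a * s + b * c + a) * hs - h6 - c * h5
  have h8 : 1 + (a * b ^ 2) ^ 2 = s * (2 - a * b ^ 2 - (a * b ^ 2) ^ 2) := by
    have h9 : a ^ 2 * s ^ 2 + a * b ^ 2 * b * s + a * b ^ 2 * b - b * s = 0 := by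
      refine mul_left_cancel₀ ha ?_
      linear_combination b ^ 2 * habc + (a * (a * s + b * c) + a * b ^ 2 * b - b) * hs
    refine mul_left_cancel₀ hb ?_
    linear_combination (1 + a * b ^ 2) * h9 + s ^ 2 * hab - b * (1 - a * b ^ 2) * h7
  apply hg
  unfold rrParamQuartic
  generalize a * b ^ 2 = k at *
  linear_combination -(1 + k ^ 2 + s * (2 - k - k ^ 2) + (2 - k - k ^ 2)) * h8
    - (2 - k - k ^ 2) ^ 2 * h7

lemma denom_ne_zero_expressing_six {u v w z : ℂ} (hu : u ≠ 0) (hv : v ≠ 0) (hw : w ≠ 0)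
    (huv : v - u ^ 2 = u * v ^ 2 * (v + u ^ 2))
    (h : z * (u ^ 2 * w - v * w + u ^ 3 * v) - u * v ^ 2 * w * (u * v - w + u ^ 3) = 0)
    (hg : rrParamQuartic (u * v ^ 2) ≠ 0) : u ^ 2 * w - v * w + u ^ 3 * v ≠ 0 := by
  intro h0
  have h1 : u * v - w + u ^ 3 = 0 := by
    refine mul_left_cancel₀ (mul_ne_zero (mul_ne_zero hu (pow_ne_zero 2 hv)) hw) ?_
    linear_combination z * h0 - h
  -- `u ^ 2 / v` is a root of `m ^ 2 + m = 1`, and equals `(1 - k) / (1 + k)` for `k = u v ^ 2`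
  have h2 : u ^ 4 + u ^ 2 * v - v ^ 2 = 0 := by
    refine mul_left_cancel₀ hu ?_
    linear_combination h0 + (u ^ 2 - v) * h1
  have h3 : 1 - 4 * (u * v ^ 2) - (u * v ^ 2) ^ 2 = 0 := by
    refine mul_left_cancel₀ (pow_ne_zero 2 hv) ?_
    linear_combination (1 + u * v ^ 2) ^ 2 * h2 +
      (v * (1 - u * v ^ 2) + u ^ 2 * (1 + u * v ^ 2) + v * (1 + u * v ^ 2)) * huv
  exact hg (by rw [rrParamQuartic, h3, zero_mul])

/-- For `u, v, w, z, y` the values at `q, q ^ 2, q ^ 3, q ^ 6, q ^ 12`. If the denominator vanishes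
then so does the numerator, and `z = u ^ 2 w ^ 3`. -/
lemma denom_ne_zero_up_to_twelve {u v w z y : ℂ} (hu : u ≠ 0) (hw : w ≠ 0) (hy : y ≠ 0)
    (hwz : z - w ^ 2 = w * z ^ 2 * (z + w ^ 2))
    (hid : v * z * (w * z + 2 * u * w ^ 2 * y + y ^ 2) =
      u * w * (u * w ^ 2 * z + 2 * z * y + u * w * y ^ 2))
    (hF : (z + w ^ 2) * (w * z + y ^ 2) = 2 * w * y) (hg : rrParamQuartic (w * z ^ 2) ≠ 0) :
    w * z + 2 * u * w ^ 2 * y + y ^ 2 ≠ 0 := by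
  intro h
  have h1 : z = u ^ 2 * w ^ 3 := by
    refine mul_left_cancel₀
      (mul_ne_zero (mul_ne_zero (mul_ne_zero two_ne_zero hy) hu) hw) ?_
    linear_combination v * z * h - u ^ 2 * w ^ 2 * h - hid
  have h2 : 1 + u * w * (z + w ^ 2) = 0 := by
    refine mul_left_cancel₀ (mul_ne_zero (mul_ne_zero two_ne_zero hw) hy) ?_
    linear_combination (z + w ^ 2) * h - hF
  have h3 : 2 * (u * w ^ 3) = w * z ^ 2 - 1 := by
    linear_combination (1 - w * z ^ 2) * h2 - u * w * hwz
  have h4 : u ^ 2 * w * (1 - w * z ^ 2) = 1 + w * z ^ 2 := by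
    refine mul_left_cancel₀ (pow_ne_zero 2 hw) ?_
    linear_combination hwz - (1 - w * z ^ 2) * h1
  have h5 : 1 - w * z ^ 2 ≠ 0 := fun h => by
    have h6 : (2 : ℂ) = 0 := by linear_combination (u ^ 2 * w + 1) * h - h4
    exact two_ne_zero h6
  have h6 : 1 - 4 * (w * z ^ 2) - (w * z ^ 2) ^ 2 = 0 := by
    have h7 : 4 * w ^ 5 * (1 + w * z ^ 2) = (1 - w * z ^ 2) ^ 3 := by
      linear_combination -4 * w ^ 5 * h4 +
        (1 - w * z ^ 2) * (2 * (u * w ^ 3) + w * z ^ 2 - 1) * h3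
    have h8 : w * z ^ 2 * (1 - w * z ^ 2) ^ 2 = w ^ 5 * (1 + w * z ^ 2) ^ 2 := by
      linear_combination w * (z * (1 - w * z ^ 2) + w ^ 2 * (1 + w * z ^ 2)) * hwz
    refine mul_left_cancel₀ (pow_ne_zero 2 h5) ?_
    linear_combination -(1 + w * z ^ 2) * h7 - 4 * h8
  exact hg (by rw [rrParamQuartic, h6, zero_mul])

/-- For `u, v, w, x, z, y, n` the values at `q, q ^ 2, q ^ 3, q ^ 4, q ^ 6, q ^ 12, q ^ 24`. If the
denominator vanishes then so does the numerator, and `z = y (y + z ^ 2) ^ 2`. -/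
lemma denom_ne_zero_up_to_twenty_four {u v w z x y n : ℂ} (hz : z ≠ 0) (hx : x ≠ 0)
    (hy : y ≠ 0) (hn : n ≠ 0)
    (hzy : y - z ^ 2 = z * y ^ 2 * (y + z ^ 2))
    (hid : v * (u * w * z) * (u * w * z * y - 2 * x * y ^ 2 * n + u * w * n ^ 2) =
      2 * u * w * z * n - x * z * y ^ 2 - x * y * n ^ 2)
    (hF : (y + z ^ 2) * (z * y + n ^ 2) = 2 * z * n) (hg : rrParamQuartic (z * y ^ 2) ≠ 0) :
    u * w * z * y - 2 * x * y ^ 2 * n + u * w * n ^ 2 ≠ 0 := by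
  intro h
  have h1 : u * w * z = x * y ^ 2 * (y + z ^ 2) := by
    refine mul_left_cancel₀ (mul_ne_zero two_ne_zero hn) ?_
    linear_combination (y + z ^ 2) * h - u * w * hF
  have h2 : u * w * (y + z ^ 2) = x * y := by
    refine mul_left_cancel₀ (mul_ne_zero (mul_ne_zero two_ne_zero hn) hz) ?_
    linear_combination v * u * w * z * (y + z ^ 2) * h - (y + z ^ 2) * hid + x * y * hF
  have h3 : z = y * (y + z ^ 2) ^ 2 := by
    refine mul_left_cancel₀ (mul_ne_zero hx hy) ?_
    linear_combination (y + z ^ 2) * h1 - z * h2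
  have h4 : (y + z ^ 2) * (1 + z * y ^ 2) = 2 * y := by linear_combination -hzy
  have h5 : z * (1 + z * y ^ 2) ^ 2 = 4 * y ^ 3 := by
    linear_combination (1 + z * y ^ 2) ^ 2 * h3 +
      y * ((y + z ^ 2) * (1 + z * y ^ 2) + 2 * y) * h4
  have h7 : 1 - 4 * (z * y ^ 2) - (z * y ^ 2) ^ 2 = 0 := by
    refine mul_left_cancel₀ hy ?_
    linear_combination (1 + z * y ^ 2) * hzy + z * h5
  exact hg (by rw [rrParamQuartic, h7, zero_mul])

theorem theorem1p2 (t : ℂ) (ht0 : t ≠ 0) (ht1 : ‖t‖ < 1) :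
    -- the continued fractions `R(q ^ n)` converge, and their values are not zero
    (∀ n : ℕ, 1 ≤ n →
      Tendsto (rrContFract (t ^ n)).convs atTop (𝓝 (rrR (t ^ n))) ∧ rrR (t ^ n) ≠ 0) ∧
    -- first identity
    (1 / (rrR (t ^ 2) * rrR (t ^ 3)) + rrR (t ^ 2) * rrR (t ^ 3) =
      1 + rrR t / rrR (t ^ 6) + rrR (t ^ 6) / rrR t) ∧
    -- second identity, with its denominator
    (rrR t ^ 2 * rrR (t ^ 4) * rrR (t ^ 8)
        - 2 * rrR t * rrR (t ^ 4) * rrR (t ^ 8) * rrR (t ^ 16)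
        + rrR t ^ 2 * rrR (t ^ 16) ^ 2 ≠ 0 ∧
      rrR (t ^ 2) =
        (rrR (t ^ 4) ^ 2 * rrR (t ^ 8) - 2 * rrR t * rrR (t ^ 4) * rrR (t ^ 16)
          + rrR (t ^ 4) * rrR (t ^ 16) ^ 2) /
        (rrR t ^ 2 * rrR (t ^ 4) * rrR (t ^ 8)
          - 2 * rrR t * rrR (t ^ 4) * rrR (t ^ 8) * rrR (t ^ 16)
          + rrR t ^ 2 * rrR (t ^ 16) ^ 2)) ∧
    -- third identity, with its denominator
    (rrR t ^ 2 * rrR (t ^ 3) - rrR (t ^ 2) * rrR (t ^ 3) + rrR t ^ 3 * rrR (t ^ 2) ≠ 0 ∧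
      rrR (t ^ 6) =
        rrR t * rrR (t ^ 2) ^ 2 * rrR (t ^ 3) *
        ((rrR t * rrR (t ^ 2) - rrR (t ^ 3) + rrR t ^ 3) /
          (rrR t ^ 2 * rrR (t ^ 3) - rrR (t ^ 2) * rrR (t ^ 3) + rrR t ^ 3 * rrR (t ^ 2)))) ∧
    -- fourth identity, with its denominator
    (rrR (t ^ 3) * rrR (t ^ 6) + 2 * rrR t * rrR (t ^ 3) ^ 2 * rrR (t ^ 12)
        + rrR (t ^ 12) ^ 2 ≠ 0 ∧
      rrR (t ^ 2) =
        rrR t * rrR (t ^ 3) / rrR (t ^ 6) *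
        ((rrR t * rrR (t ^ 3) ^ 2 * rrR (t ^ 6) + 2 * rrR (t ^ 6) * rrR (t ^ 12)
            + rrR t * rrR (t ^ 3) * rrR (t ^ 12) ^ 2) /
          (rrR (t ^ 3) * rrR (t ^ 6) + 2 * rrR t * rrR (t ^ 3) ^ 2 * rrR (t ^ 12)
            + rrR (t ^ 12) ^ 2))) ∧
    -- fifth identity, with its denominator
    (rrR t * rrR (t ^ 3) * rrR (t ^ 6) * rrR (t ^ 12)
        - 2 * rrR (t ^ 4) * rrR (t ^ 12) ^ 2 * rrR (t ^ 24)
        + rrR t * rrR (t ^ 3) * rrR (t ^ 24) ^ 2 ≠ 0 ∧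
      rrR (t ^ 2) =
        1 / (rrR t * rrR (t ^ 3) * rrR (t ^ 6)) *
        ((2 * rrR t * rrR (t ^ 3) * rrR (t ^ 6) * rrR (t ^ 24)
            - rrR (t ^ 4) * rrR (t ^ 6) * rrR (t ^ 12) ^ 2
            - rrR (t ^ 4) * rrR (t ^ 12) * rrR (t ^ 24) ^ 2) /
          (rrR t * rrR (t ^ 3) * rrR (t ^ 6) * rrR (t ^ 12)
            - 2 * rrR (t ^ 4) * rrR (t ^ 12) ^ 2 * rrR (t ^ 24)
            + rrR t * rrR (t ^ 3) * rrR (t ^ 24) ^ 2))) := by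
  have R0 : ∀ n : ℕ, n ≠ 0 → rrR (t ^ n) ≠ 0 := fun n hn =>
    rrR_ne_zero (pow_ne_zero n ht0) (norm_pow_lt_one ht1 hn)
  have quartic : ∀ n : ℕ, n ≠ 0 →
      rrParamQuartic (rrR (t ^ n) * rrR (t ^ (n * 2)) ^ 2) ≠ 0 := fun n hn => by
    rw [pow_mul]
    exact rrParamQuartic_ne_zero (pow_ne_zero n ht0) (norm_pow_lt_one ht1 hn)
  have two : ∀ n : ℕ, n ≠ 0 → _ := rrR_modular_two_pow ht1
  have four : ∀ n : ℕ, n ≠ 0 → _ := rrR_one_two_four ht1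
  obtain ⟨hL1, hL2, hid1⟩ := rrR_one_two_three_six ht1 1 one_ne_zero
  obtain ⟨hL1b, hL2b, hid1b⟩ := rrR_one_two_three_six ht1 2 two_ne_zero
  have P12 := two 1 (by norm_num)
  have P24 := two 2 (by norm_num)
  have P36 := two 3 (by norm_num)
  have P48 := two 4 (by norm_num)
  have P612 := two 6 (by norm_num)
  have Q1 := four 1 (by norm_num)
  have Q2 := four 2 (by norm_num)
  have Q3 := four 3 (by norm_num)
  have Q4 := four 4 (by norm_num)
  have Q6 := four 6 (by norm_num)
  have G1 := quartic 1 (by norm_num)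
  have G3 := quartic 3 (by norm_num)
  have G6 := quartic 6 (by norm_num)
  norm_num only [pow_one] at hL1 hL2 hid1 hL1b hL2b hid1b P12 P24 P36 P48 P612
  norm_num only [pow_one] at Q1 Q2 Q3 Q4 Q6 G1 G3 G6
  have hu : rrR t ≠ 0 := rrR_ne_zero ht0 ht1
  have hv := R0 2 (by norm_num)
  have hw := R0 3 (by norm_num)
  have hx := R0 4 (by norm_num)
  have hz := R0 6 (by norm_num)
  have he := R0 8 (by norm_num)
  have hy := R0 12 (by norm_num)
  have hm := R0 16 (by norm_num)
  have hn := R0 24 (by norm_num)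
  have conv : ∀ n : ℕ, 1 ≤ n →
      Tendsto (rrContFract (t ^ n)).convs atTop (𝓝 (rrR (t ^ n))) ∧ rrR (t ^ n) ≠ 0 :=
    fun n h => by
      have hn0 : n ≠ 0 := by omega
      refine ⟨?_, R0 n hn0⟩
      rw [rrR_eq (norm_pow_lt_one ht1 hn0)]
      exact tendsto_rrContFract_convs (norm_pow_lt_one ht1 hn0)
  refine ⟨conv, ?_⟩
  -- from here on the argument is algebra in nine numbers
  clear conv R0 quartic two four
  generalize rrR t = u at *
  generalize rrR (t ^ 2) = v at *
  generalize rrR (t ^ 3) = w at *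
  generalize rrR (t ^ 4) = x at *
  generalize rrR (t ^ 6) = z at *
  generalize rrR (t ^ 8) = e at *
  generalize rrR (t ^ 12) = y at *
  generalize rrR (t ^ 16) = m at *
  generalize rrR (t ^ 24) = n at *
  have hid3 := relation_expressing_six P12 hL1 hL2
  have hid4 := relation_mul_sub_sq_mul_sq P12 P36 hL2 hid1
  have hid4b := relation_mul_sub_sq_mul_sq P24 P612 hL2b hid1b
  have hid5 := relation_up_to_twelve P12 P36 P24 P612 Q1 Q3 hL1 hL1b hL2 hL2b hid1 hid1b hid4 hid4b
  have F4 := add_sq_mul_add_sq hx P48 Q4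
  have F3 := add_sq_mul_add_sq hw P36 Q3
  have F6 := add_sq_mul_add_sq hz P612 Q6
  have hfour : v * z * (w * z + 2 * u * w ^ 2 * y + y ^ 2) =
      u * w * (u * w ^ 2 * z + 2 * z * y + u * w * y ^ 2) := by
    linear_combination (w * z + y ^ 2) * hid4 + u * z * (1 - v * w) * F3
  have hfive : v * (u * w * z) * (u * w * z * y - 2 * x * y ^ 2 * n + u * w * n ^ 2) =
      2 * u * w * z * n - x * z * y ^ 2 - x * y * n ^ 2 := by
    linear_combination (z * y + n ^ 2) * hid5 + u * w * (1 + v * x * y ^ 2) * F6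
  have D2 := denom_ne_zero_up_to_sixteen hu hv hx hm P12 Q1 Q2 F4 G1
  have D3 := denom_ne_zero_expressing_six hu hv hw P12 hid3 G1
  have D4 := denom_ne_zero_up_to_twelve hu hw hy P36 hfour F3 G3
  have D5 := denom_ne_zero_up_to_twenty_four hz hx hy hn P612 hfive F6 G6
  have huwz : u * w * z ≠ 0 := mul_ne_zero (mul_ne_zero hu hw) hz
  refine ⟨?_, ⟨?_, ?_⟩, ⟨D3, ?_⟩, ⟨?_, ?_⟩, ⟨?_, ?_⟩⟩
  · field_simp
    linear_combination hid1
  · exact D2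
  · rw [eq_div_iff D2]
    linear_combination cleared_identity_up_to_sixteen Q1 Q2 F4
  · rw [mul_div_assoc', eq_div_iff D3]
    linear_combination hid3
  · exact D4
  · rw [div_mul_div_comm, eq_div_iff (mul_ne_zero hz D4)]
    linear_combination hfour
  · exact D5
  · rw [div_mul_div_comm, eq_div_iff (mul_ne_zero huwz D5)]
    linear_combination hfive
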